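/- Setting. Let $\mathbb F_q$ be a finite field of characteristic $\neq 2,3$, let $f(x)=x^3+Ax+B$ with $A,B\in\mathbb F_q$ and $4A^3+27B^2\ne 0$, and let $E: y^2=f(x)$. Let $\varphi(x,y)=(x^q,y^q)$ on $E(\mathbb F_{q^3})$ and $T_3=\{Q\in E(\mathbb F_{q^3}) : Q+\varphi(Q)+\varphi^2(Q)=P_\infty\}$. Assume that $T_3=\langle P\rangle$ is cyclic of prime order $p>10800$. For $Q\in T_3\setminus\{P_\infty\}$ let $h_Q=y-(\alpha_1x+\alpha_0)$, $\alpha_i\in\mathbb F_q$, be the equation of the line through $Q,\varphi(Q),\varphi^2(Q)$. Let $s$ be the residue modulo $p$ with $\varphi(P)=sP$, let $$M=\left\{\tfrac{\pm3}{2s+1},\tfrac{s-4}{3s},\tfrac{4s-1}{2s+1},\tfrac{s+5}{3(s+1)},\tfrac{4s+5}{2s+1}\right\}\subseteq\mathbb Z/p\mathbb Z,$$ and let $\mathcal M$ be the set of odd integers in $[0,p)$ whose residue lies in $M$. Doubling. For $h=y-(\alpha_1x+\alpha_0)$ let $D(h)=y-(u_1x+u_0)/c$, where $u_1=4B\alpha_1^4-4A\alpha_1^3\alpha_0+4A^2\alpha_1^2-4\alpha_1\alpha_0^3+36B\alpha_1\alpha_0-12A\alpha_0^2$,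 $u_0=-A^2\alpha_1^4-8B\alpha_1^3\alpha_0+2A\alpha_1^2\alpha_0^2+6AB\alpha_1^2-8A^2\alpha_1\alpha_0-\alpha_0^4-18B\alpha_0^2+4A^3+27B^2$, $c=8B\alpha_1^3-8A\alpha_1^2\alpha_0-8\alpha_0^3$. Subalgorithm. For two lines $h_Q,h_R$ the polynomial $S_{Q,R}=S_1(x)+yS_2(x)=(a_4x^4+\dots+a_0)+y(b_3x^3+\dots+b_0)$, with divisor $\sum_{0\le i,j\le2}(\varphi^i(Q)+\varphi^j(R))-9P_\infty$ on $E$, is unique up to a nonzero constant and depends only on $h_Q$ and $h_R$; the $a_i,b_i$ are computed as explicit polynomials with integer coefficients in $A$, $B$ and the coefficients of the two lines, and scaled so that $b_3=1$ whenever $b_3\neq0$. For a monic cubic $W=x^3+w_2x^2+w_1x+w_0$ and $S=S_1+yS_2$ with $b_3=1$, let $L(W,S)$ be the linear system in $(\gamma_1,\gamma_0)$ with augmented matrix $$\begin{pmatrix} w_0(w_2-b_2)&b_0-w_0&w_0a_3-a_4w_2w_0-a_0\\ w_0(w_1-b_1)&b_0w_2-w_0b_2&w_0a_2-a_4w_1w_0-a_0w_2\\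 w_0(w_0-b_0)&b_0w_1-b_1w_0&w_0a_1-a_4w_0^2-a_0w_1\end{pmatrix},$$ whose solution gives the line $y-(\gamma_1x+\gamma_0)$. For a line $h$ write $\bar h(x,y)=-h(x,-y)$. The output $\mathrm{Subalg}(g_1,g_2,g_3,g_4)$ is obtained as follows. (1) If $g_1=g_2$, return $\bar g_1$; if $g_3=g_4$, return $\bar g_3$. (2) Compute $S=S_1+yS_2$ from $g_1,g_2$ and $T=T_1+yT_2$ from $g_3,g_4$. If $g_1=\bar g_2$, return the solution of $L(W,T)$, where $W$ is the monic multiple of $S_1$; if $g_3=\bar g_4$, return the solution of $L(W,S)$, where $W$ is the monic multiple of $T_1$. (3) Otherwise run, in any order, through the distinct monic irreducible factors $W$ of degree $3$ in $\mathbb F_q[x]$ of $\gcd(fS_2^2-S_1^2,\,fT_2^2-T_1^2)$. If $W\ne S_2$, solve $L(W,S)$, and return the solution $y-(\gamma_1x+\gamma_0)$ if $W\mid(\gamma_1x+\gamma_0)T_2+T_1$, else pass to the next $W$. If $W=S_2$, return the solution of $L(W,T)$. Proposition. Let $0<m<p$, let $m=\sum_{i=0}^{\ell-1}m_i2^i$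 with $m_i\in\{0,1\}$ and $m_{\ell-1}=1$, and let $k_i=\sum_{j=i}^{\ell-1}m_j2^{j-i}$. For $i$ from $\ell-1$ down to $0$ define $u_i,v_i$ recursively as follows. * $u_{\ell-1}=h_P$, $v_{\ell-1}=h_{2P}$. * $(u_{\ell-2},v_{\ell-2})=(h_{2P},h_{3P})$ if $m_{\ell-2}=0$, and $(h_{3P},h_{4P})$ if $m_{\ell-2}=1$. * For $0\le i\le\ell-3$ put $(u_i,v_i)=(D(u_{i+1}),w_i)$ if $m_i=0$ and $(u_i,v_i)=(w_i,D(v_{i+1}))$ if $m_i=1$, where - (general case) if $k_i,k_i+1\notin\mathcal M$, then $w_i=\mathrm{Subalg}(h_P,D(u_{i+1}),u_{i+1},v_{i+1})$; - (special case) if $k_i\in\mathcal M$ or $k_i+1\in\mathcal M$, then $$w_i=\begin{cases}\mathrm{Subalg}(h_{3P},D^2(u_{i+2}),h_{7P},D^3(u_{i+3}))& m_{i+1}=m_{i+2}=1,\\ \mathrm{Subalg}(h_{3P},D^3(u_{i+3}),h_{-5P},D^3(v_{i+3}))& m_{i+1}=1,\ m_{i+2}=0,\\ \mathrm{Subalg}(h_{-3P},D^3(v_{i+3}),h_{5P},D^3(u_{i+3}))&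 m_{i+1}=0,\ m_{i+2}=1,\\ \mathrm{Subalg}(h_{-3P},D^2(v_{i+2}),h_{-7P},D^3(v_{i+3}))& m_{i+1}=m_{i+2}=0.\end{cases}$$ Then for every $i\in\{0,\dots,\ell-1\}$ all computations needed for $u_i$ succeed and $u_i=h_{k_iP}$; and, if $k_i+1\ne p$, all computations needed for $v_i$ succeed and $v_i=h_{(k_i+1)P}$. (The exception $k_i+1=p$ occurs only for $m=p-1$, $i=0$, where $h_{(k_i+1)P}=h_{P_\infty}$ is not defined.) -/

import Mathlib

open Polynomial

namespace T3

noncomputable section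

section Curve

variable {F : Type*} [Field F]

/-- The cubic `f = x³ + A x + B`. -/
def cubic (A B : F) : F[X] := X ^ 3 + C A * X + C B

/-- The curve `y² = x³ + A x + B` in short Weierstrass form. -/
def curve (A B : F) : WeierstrassCurve F := ⟨0, 0, 0, A, B⟩

/-- The points of `y² = x³ + A x + B` over an extension `K` of `F`, with the point at infinity. -/
abbrev Points (K : Type*) [Field K] [Algebra F K] (A B : F) : Type _ :=
  ((curve A B).baseChange K).toAffine.Point

variable [Fintype F] {K : Type*} [Field K] [DecidableEq K] [Algebra F K] {A B : F}

/-- The Frobenius endomorphism `(x, y) ↦ (x ^ q, y ^ q)` of the group of `K`-points, `q = #F`. -/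
def frob : Points K A B →+ Points K A B :=
  WeierstrassCurve.Affine.Point.map (W' := curve A B) (FiniteField.frobeniusAlgHom F K)

/-- The trace zero subgroup `{Q | Q + φ(Q) + φ²(Q) = 0}`. -/
def traceZero (K : Type*) [Field K] [DecidableEq K] [Algebra F K] (A B : F) :
    AddSubgroup (Points K A B) :=
  (AddMonoidHom.id (Points K A B) + frob + frob.comp frob).ker

end Curve

/-- The non-vertical line `y - (a₁ x + a₀)`, given by its two coefficients. -/
@[ext]
structure Line (F : Type*) where
  a₁ : F
  a₀ : F

section Lines

variable {F : Type*} [Field F]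

/-- The line `y + (a₁ x + a₀)`, that is `-h(x, -y)` for `h = y - (a₁ x + a₀)`. -/
def Line.neg (L : Line F) : Line F := ⟨-L.a₁, -L.a₀⟩

variable [Fintype F] {K : Type*} [Field K] [Algebra F K] {A B : F}

/-- `L` is the line `h_Q` through `Q`, `φ(Q)`, `φ²(Q)`: the point `Q = (x, y)` is affine and lies on
`L` (hence so do its conjugates, `L` being defined over `F`), and `L` meets the curve exactly in
`Q`, `φ(Q)`, `φ²(Q)`, counted with multiplicity. -/
def IsLineOf (L : Line F) (Q : Points K A B) : Prop :=
  ∃ (x y : K) (h : ((curve A B).baseChange K).toAffine.Nonsingular x y),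
    Q = WeierstrassCurve.Affine.Point.some x y h ∧
    y = algebraMap F K L.a₁ * x + algebraMap F K L.a₀ ∧
    (cubic A B - (C L.a₁ * X + C L.a₀) ^ 2).map (algebraMap F K) =
      (X - C x) * (X - C (x ^ Fintype.card F)) * (X - C (x ^ Fintype.card F ^ 2))

/-- In odd characteristic a point has at most one such line. -/
theorem IsLineOf.unique (h2 : ringChar F ≠ 2) {L L' : Line F} {Q : Points K A B}
    (h : IsLineOf L Q) (h' : IsLineOf L' Q) : L = L' := by
  obtain ⟨x, y, hn, rfl, hy, hf⟩ := h
  obtain ⟨x', y', hn', he, hy', hf'⟩ := h'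
  obtain ⟨rfl, rfl⟩ := WeierstrassCurve.Affine.Point.some.inj he
  have h2F : (2 : F) ≠ 0 := Ring.two_ne_zero h2
  have hinj := (algebraMap F K).injective
  have hpoly := Polynomial.map_injective _ hinj (hf.trans hf'.symm)
  have hprod : (C (L.a₁ - L'.a₁) * X + C (L.a₀ - L'.a₀)) *
      (C (L.a₁ + L'.a₁) * X + C (L.a₀ + L'.a₀)) = 0 := by
    simp only [C_add, C_sub]
    linear_combination -hpoly
  rcases mul_eq_zero.1 hprod with h0 | h0
  · have e1 := congrArg (fun g => coeff g 1) h0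
    have e0 := congrArg (fun g => coeff g 0) h0
    simp [coeff_X, coeff_C] at e1 e0
    exact Line.ext (sub_eq_zero.1 e1) (sub_eq_zero.1 e0)
  · have e1 := congrArg (fun g => coeff g 1) h0
    have e0 := congrArg (fun g => coeff g 0) h0
    simp [coeff_X, coeff_C] at e1 e0
    have f1 : L'.a₁ = -L.a₁ := by linear_combination e1
    have f0 : L'.a₀ = -L.a₀ := by linear_combination e0
    have h2K : (2 : K) ≠ 0 := by
      have h2' := (_root_.map_ne_zero (algebraMap F K)).2 h2F
      rwa [map_ofNat] at h2'
    have hy0 : y = 0 := by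
      rw [f1, f0, map_neg, map_neg] at hy'
      have : (2 : K) * y = 0 := by linear_combination hy + hy'
      exact (mul_eq_zero.1 this).resolve_left h2K
    by_cases ha : L.a₁ = 0
    · have : algebraMap F K L.a₀ = 0 := by rw [hy0, ha] at hy; simpa using hy.symm
      have hb : L.a₀ = 0 := (map_eq_zero _).1 this
      exact Line.ext (by rw [f1, ha, neg_zero]) (by rw [f0, hb, neg_zero])
    · exfalso
      have hx : x = algebraMap F K (-L.a₀ / L.a₁) := by
        have : algebraMap F K L.a₁ ≠ 0 := (_root_.map_ne_zero _).2 ha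
        rw [map_div₀, map_neg, eq_div_iff this]
        linear_combination -hy + hy0
      have hxq : x ^ Fintype.card F = x := by rw [hx, ← map_pow, FiniteField.pow_card]
      have hxq2 : x ^ Fintype.card F ^ 2 = x := by rw [pow_two, pow_mul, hxq, hxq]
      rw [hxq, hxq2] at hf
      have hd := congrArg (fun g => (derivative g).eval x) hf
      simp [cubic, pow_two (C _ * X + C _)] at hd
      rw [WeierstrassCurve.Affine.nonsingular_iff] at hn
      simp [curve, hy0] at hn
      apply hn.2
      linear_combination (-1 : K) * hd - 2 * algebraMap F K L.a₁ * (hy0 - hy)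

open Classical in
/-- The line `h_Q`, when it exists. -/
def lineOf (Q : Points K A B) : Option (Line F) :=
  if h : ∃ L : Line F, IsLineOf L Q then some h.choose else none

end Lines

section Formulas

variable {F : Type*} [Field F]

/-! Doubling: `h_{2Q} = c y - (u₁ x + u₀)` up to a constant, for `h_Q = y - (a₁ x + a₀)`. -/

def dblU1 (A B a₁ a₀ : F) : F :=
  4 * B * a₁ ^ 4 - 4 * A * a₁ ^ 3 * a₀ + 4 * A ^ 2 * a₁ ^ 2 - 4 * a₁ * a₀ ^ 3 + 36 * B * a₁ *
    a₀ - 12 * A * a₀ ^ 2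

def dblU0 (A B a₁ a₀ : F) : F :=
  -A ^ 2 * a₁ ^ 4 - 8 * B * a₁ ^ 3 * a₀ + 2 * A * a₁ ^ 2 * a₀ ^ 2 + 6 * A * B * a₁ ^ 2 - 8 *
    A ^ 2 * a₁ * a₀ - a₀ ^ 4 - 18 * B * a₀ ^ 2 + 4 * A ^ 3 + 27 * B ^ 2

def dblC (A B a₁ a₀ : F) : F :=
  8 * B * a₁ ^ 3 - 8 * A * a₁ ^ 2 * a₀ - 8 * a₀ ^ 3

open Classical in
/-- The doubling `D`, which divides the doubling formulas by `c`. It fails if `c = 0`. -/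
def dbl (A B : F) (L : Line F) : Option (Line F) :=
  if dblC A B L.a₁ L.a₀ = 0 then none
  else some ⟨dblU1 A B L.a₁ L.a₀ / dblC A B L.a₁ L.a₀, dblU0 A B L.a₁ L.a₀ / dblC A B L.a₁ L.a₀⟩

/-! The coefficients of `S_{Q,R} = (a₄x⁴ + a₃x³ + a₂x² + a₁x + a₀) + y (b₃x³ + b₂x² + b₁x + b₀)` for
`h_Q = y - (a₁ x + a₀)` and `h_R = y - (b₁ x + b₀)`: below `sA4, …, sA0` are the coefficients of the
first summand, and `sB3, …, sB0` those of the second one. -/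

def sA4 (A B a₁ a₀ b₁ b₀ : F) : F :=
  -a₁ ^ 3 * b₁ * b₀ ^ 2 - 3 * B * a₁ ^ 3 * b₁ + 2 * A * a₁ ^ 3 * b₀ + 2 * a₁ ^ 2 * a₀ * b₁ ^
    2 * b₀ + A * a₁ ^ 2 * a₀ * b₁ - 6 * B * a₁ ^ 2 * b₁ ^ 2 + 3 * A * a₁ ^ 2 * b₁ * b₀ + A ^
    2 * a₁ ^ 2 - a₁ * a₀ ^ 2 * b₁ ^ 3 + 6 * a₁ * a₀ ^ 2 * b₀ + 3 * A * a₁ * a₀ * b₁ ^ 2 + 3 *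
    a₁ * a₀ * b₀ ^ 2 + 9 * B * a₁ * a₀ - 3 * B * a₁ * b₁ ^ 3 + A * a₁ * b₁ ^ 2 * b₀ + 2 * A ^
    2 * a₁ * b₁ - 3 * a₁ * b₀ ^ 3 + 9 * B * a₁ * b₀ - 3 * a₀ ^ 3 * b₁ + 3 * a₀ ^ 2 * b₁ * b₀ -
    3 * A * a₀ ^ 2 + 2 * A * a₀ * b₁ ^ 3 + 6 * a₀ * b₁ * b₀ ^ 2 + 9 * B * a₀ * b₁ - 6 * A *
    a₀ * b₀ + A ^ 2 * b₁ ^ 2 + 9 * B * b₁ * b₀ - 3 * A * b₀ ^ 2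

def sA3 (A B a₁ a₀ b₁ b₀ : F) : F :=
  4 * B * a₁ ^ 3 * b₁ ^ 3 - 2 * A * a₁ ^ 3 * b₁ ^ 2 * b₀ + A ^ 2 * a₁ ^ 3 * b₁ - a₁ ^ 3 * b₀ ^
    3 + 9 * B * a₁ ^ 3 * b₀ - 2 * A * a₁ ^ 2 * a₀ * b₁ ^ 3 - a₁ ^ 2 * a₀ * b₁ * b₀ ^ 2 + 3 *
    B * a₁ ^ 2 * a₀ * b₁ - 7 * A * a₁ ^ 2 * a₀ * b₀ + A ^ 2 * a₁ ^ 2 * b₁ ^ 2 - 6 * B * a₁ ^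
    2 * b₁ * b₀ + 3 * A * a₁ ^ 2 * b₀ ^ 2 + 6 * A * B * a₁ ^ 2 - a₁ * a₀ ^ 2 * b₁ ^ 2 * b₀ +
    A * a₁ * a₀ ^ 2 * b₁ - 6 * B * a₁ * a₀ * b₁ ^ 2 + 12 * A * a₁ * a₀ * b₁ * b₀ - 8 * A ^ 2 *
    a₁ * a₀ + A ^ 2 * a₁ * b₁ ^ 3 + 3 * B * a₁ * b₁ ^ 2 * b₀ + A * a₁ * b₁ * b₀ ^ 2 - 6 * A *
    B * a₁ * b₁ + 4 * A ^ 2 * a₁ * b₀ - a₀ ^ 3 * b₁ ^ 3 - 3 * a₀ ^ 3 * b₀ + 3 * A * a₀ ^ 2 *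
    b₁ ^ 2 + 21 * a₀ ^ 2 * b₀ ^ 2 - 18 * B * a₀ ^ 2 + 9 * B * a₀ * b₁ ^ 3 - 7 * A * a₀ * b₁ ^
    2 * b₀ + 4 * A ^ 2 * a₀ * b₁ - 3 * a₀ * b₀ ^ 3 + 18 * B * a₀ * b₀ + 6 * A * B * b₁ ^ 2 -
    8 * A ^ 2 * b₁ * b₀ - 18 * B * b₀ ^ 2 + 4 * A ^ 3 + 27 * B ^ 2

def sA2 (A B a₁ a₀ b₁ b₀ : F) : F :=
  -A ^ 2 * a₁ ^ 3 * b₁ ^ 3 - 2 * A * a₁ ^ 3 * b₁ * b₀ ^ 2 - 6 * A * B * a₁ ^ 3 * b₁ + A ^ 2 *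
    a₁ ^ 3 * b₀ - 2 * A * a₁ ^ 2 * a₀ * b₁ ^ 2 * b₀ + 5 * A ^ 2 * a₁ ^ 2 * a₀ * b₁ - 3 * a₁ ^
    2 * a₀ * b₀ ^ 3 - 9 * B * a₁ ^ 2 * a₀ * b₀ + 6 * A * B * a₁ ^ 2 * b₁ ^ 2 + 9 * B * a₁ ^
    2 * b₀ ^ 2 + (2 * A ^ 3 + 27 * B ^ 2) * a₁ ^ 2 - 2 * A * a₁ * a₀ ^ 2 * b₁ ^ 3 - 3 * a₁ *
    a₀ ^ 2 * b₁ * b₀ ^ 2 + 9 * B * a₁ * a₀ ^ 2 * b₁ + 9 * A * a₁ * a₀ ^ 2 * b₀ + 36 * B * a₁ *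
    a₀ * b₁ * b₀ - 12 * A * a₁ * a₀ * b₀ ^ 2 - 18 * A * B * a₁ * a₀ - 6 * A * B * a₁ * b₁ ^
    3 + 5 * A ^ 2 * a₁ * b₁ ^ 2 * b₀ + 9 * B * a₁ * b₁ * b₀ ^ 2 + (4 * A ^ 3 - 27 * B ^ 2) *
    a₁ * b₁ - 3 * A * a₁ * b₀ ^ 3 + 36 * A * B * a₁ * b₀ - 3 * a₀ ^ 3 * b₁ ^ 2 * b₀ - 3 * A *
    a₀ ^ 3 * b₁ + 9 * B * a₀ ^ 2 * b₁ ^ 2 - 12 * A * a₀ ^ 2 * b₁ * b₀ + 6 * A ^ 2 * a₀ ^ 2 +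
    A ^ 2 * a₀ * b₁ ^ 3 - 9 * B * a₀ * b₁ ^ 2 * b₀ + 9 * A * a₀ * b₁ * b₀ ^ 2 + 36 * A * B *
    a₀ * b₁ - 24 * A ^ 2 * a₀ * b₀ + (2 * A ^ 3 + 27 * B ^ 2) * b₁ ^ 2 - 18 * A * B * b₁ *
    b₀ + 6 * A ^ 2 * b₀ ^ 2

def sA1 (A B a₁ a₀ b₁ b₀ : F) : F :=
  -A ^ 2 * a₁ ^ 3 * b₁ ^ 2 * b₀ - 4 * B * a₁ ^ 3 * b₁ * b₀ ^ 2 + (A ^ 3 - 12 * B ^ 2) * a₁ ^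
    3 * b₁ + 8 * A * B * a₁ ^ 3 * b₀ - A ^ 2 * a₁ ^ 2 * a₀ * b₁ ^ 3 - 4 * B * a₁ ^ 2 * a₀ *
    b₁ ^ 2 * b₀ + 16 * A * B * a₁ ^ 2 * a₀ * b₁ - 3 * A ^ 2 * a₁ ^ 2 * a₀ * b₀ + (-3 * A ^ 3 +
    12 * B ^ 2) * a₁ ^ 2 * b₁ ^ 2 - 24 * A * B * a₁ ^ 2 * b₁ * b₀ + 3 * A ^ 2 * a₁ ^ 2 * b₀ ^
    2 - 2 * A ^ 2 * B * a₁ ^ 2 - 4 * B * a₁ * a₀ ^ 2 * b₁ ^ 3 - 3 * A ^ 2 * a₁ * a₀ ^ 2 * b₁ -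
    3 * a₁ * a₀ ^ 2 * b₀ ^ 3 + 15 * B * a₁ * a₀ ^ 2 * b₀ - 24 * A * B * a₁ * a₀ * b₁ ^ 2 +
    12 * A ^ 2 * a₁ * a₀ * b₁ * b₀ - 6 * B * a₁ * a₀ * b₀ ^ 2 - 18 * B ^ 2 * a₁ * a₀ + (A ^
    3 - 12 * B ^ 2) * a₁ * b₁ ^ 3 + 16 * A * B * a₁ * b₁ ^ 2 * b₀ - 3 * A ^ 2 * a₁ * b₁ * b₀ ^
    2 + 14 * A ^ 2 * B * a₁ * b₁ - 3 * B * a₁ * b₀ ^ 3 + 63 * B ^ 2 * a₁ * b₀ - 3 * a₀ ^ 3 *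
    b₁ * b₀ ^ 2 - 3 * B * a₀ ^ 3 * b₁ - 3 * A * a₀ ^ 3 * b₀ + 3 * A ^ 2 * a₀ ^ 2 * b₁ ^ 2 -
    6 * B * a₀ ^ 2 * b₁ * b₀ + 9 * A * a₀ ^ 2 * b₀ ^ 2 + 6 * A * B * a₀ ^ 2 + 8 * A * B * a₀ *
    b₁ ^ 3 - 3 * A ^ 2 * a₀ * b₁ ^ 2 * b₀ + 15 * B * a₀ * b₁ * b₀ ^ 2 + 63 * B ^ 2 * a₀ * b₁ -
    3 * A * a₀ * b₀ ^ 3 - 42 * A * B * a₀ * b₀ - 2 * A ^ 2 * B * b₁ ^ 2 - 18 * B ^ 2 * b₁ *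
    b₀ + 6 * A * B * b₀ ^ 2 + 4 * A ^ 4 + 27 * A * B ^ 2

def sA0 (A B a₁ a₀ b₁ b₀ : F) : F :=
  2 * A ^ 2 * B * a₁ ^ 3 * b₁ - A ^ 3 * a₁ ^ 3 * b₀ - A ^ 2 * a₁ ^ 2 * a₀ * b₁ ^ 2 * b₀ - 4 *
    B * a₁ ^ 2 * a₀ * b₁ * b₀ ^ 2 + 12 * B ^ 2 * a₁ ^ 2 * a₀ * b₁ - 4 * A * B * a₁ ^ 2 * a₀ *
    b₀ - 5 * A ^ 2 * B * a₁ ^ 2 * b₁ ^ 2 + (A ^ 3 - 24 * B ^ 2) * a₁ ^ 2 * b₁ * b₀ + 6 * A *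
    B * a₁ ^ 2 * b₀ ^ 2 + (A ^ 4 + 6 * A * B ^ 2) * a₁ ^ 2 - 4 * B * a₁ * a₀ ^ 2 * b₁ ^ 2 *
    b₀ + 2 * A * a₁ * a₀ ^ 2 * b₁ * b₀ ^ 2 - 2 * A * B * a₁ * a₀ ^ 2 * b₁ - A ^ 2 * a₁ * a₀ ^
    2 * b₀ + (A ^ 3 - 24 * B ^ 2) * a₁ * a₀ * b₁ ^ 2 + 24 * A * B * a₁ * a₀ * b₁ * b₀ - 3 *
    A ^ 2 * a₁ * a₀ * b₀ ^ 2 + A ^ 2 * B * a₁ * a₀ + 2 * A ^ 2 * B * a₁ * b₁ ^ 3 + 12 * B ^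
    2 * a₁ * b₁ ^ 2 * b₀ - 2 * A * B * a₁ * b₁ * b₀ ^ 2 + (-2 * A ^ 4 - 6 * A * B ^ 2) * a₁ *
    b₁ - 5 * A ^ 2 * B * a₁ * b₀ - a₀ ^ 3 * b₀ ^ 3 - 3 * B * a₀ ^ 3 * b₀ + 6 * A * B * a₀ ^
    2 * b₁ ^ 2 - 3 * A ^ 2 * a₀ ^ 2 * b₁ * b₀ + 3 * B * a₀ ^ 2 * b₀ ^ 2 + (A ^ 3 + 9 * B ^
    2) * a₀ ^ 2 - A ^ 3 * a₀ * b₁ ^ 3 - 4 * A * B * a₀ * b₁ ^ 2 * b₀ - A ^ 2 * a₀ * b₁ * b₀ ^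
    2 - 5 * A ^ 2 * B * a₀ * b₁ - 3 * B * a₀ * b₀ ^ 3 + (2 * A ^ 3 - 9 * B ^ 2) * a₀ * b₀ +
    (A ^ 4 + 6 * A * B ^ 2) * b₁ ^ 2 + A ^ 2 * B * b₁ * b₀ + (A ^ 3 + 9 * B ^ 2) * b₀ ^ 2 +
    4 * A ^ 3 * B + 27 * B ^ 3

def sB3 (A B a₁ a₀ b₁ b₀ : F) : F :=
  a₁ ^ 3 * b₀ ^ 2 - B * a₁ ^ 3 - 2 * a₁ ^ 2 * a₀ * b₁ * b₀ + A * a₁ ^ 2 * a₀ + a₁ ^ 2 * b₁ *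
    b₀ ^ 2 - 3 * B * a₁ ^ 2 * b₁ + A * a₁ ^ 2 * b₀ + a₁ * a₀ ^ 2 * b₁ ^ 2 - 2 * a₁ * a₀ * b₁ ^
    2 * b₀ + 2 * A * a₁ * a₀ * b₁ - 3 * B * a₁ * b₁ ^ 2 + 2 * A * a₁ * b₁ * b₀ + a₀ ^ 3 + a₀ ^
    2 * b₁ ^ 3 + 3 * a₀ ^ 2 * b₀ + A * a₀ * b₁ ^ 2 + 3 * a₀ * b₀ ^ 2 - B * b₁ ^ 3 + A * b₁ ^
    2 * b₀ + b₀ ^ 3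

def sB2 (A B a₁ a₀ b₁ b₀ : F) : F :=
  A ^ 2 * a₁ ^ 3 + 3 * a₁ ^ 2 * a₀ * b₀ ^ 2 + 9 * B * a₁ ^ 2 * a₀ + 3 * A ^ 2 * a₁ ^ 2 * b₁ +
    3 * a₁ ^ 2 * b₀ ^ 3 + 9 * B * a₁ ^ 2 * b₀ - 6 * a₁ * a₀ ^ 2 * b₁ * b₀ - 3 * A * a₁ * a₀ ^
    2 - 6 * a₁ * a₀ * b₁ * b₀ ^ 2 + 18 * B * a₁ * a₀ * b₁ - 6 * A * a₁ * a₀ * b₀ + 3 * A ^ 2 *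
    a₁ * b₁ ^ 2 + 18 * B * a₁ * b₁ * b₀ - 3 * A * a₁ * b₀ ^ 2 + 3 * a₀ ^ 3 * b₁ ^ 2 + 3 * a₀ ^
    2 * b₁ ^ 2 * b₀ - 3 * A * a₀ ^ 2 * b₁ + 9 * B * a₀ * b₁ ^ 2 - 6 * A * a₀ * b₁ * b₀ + A ^
    2 * b₁ ^ 3 + 9 * B * b₁ ^ 2 * b₀ - 3 * A * b₁ * b₀ ^ 2

def sB1 (A B a₁ a₀ b₁ b₀ : F) : F :=
  -A ^ 2 * a₁ ^ 3 * b₁ ^ 2 - 2 * A * a₁ ^ 3 * b₀ ^ 2 + 2 * A * B * a₁ ^ 3 - 12 * B * a₁ ^ 2 *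
    a₀ * b₁ ^ 2 + 4 * A * a₁ ^ 2 * a₀ * b₁ * b₀ - 3 * A ^ 2 * a₁ ^ 2 * a₀ - A ^ 2 * a₁ ^ 2 *
    b₁ ^ 3 - 12 * B * a₁ ^ 2 * b₁ ^ 2 * b₀ + 4 * A * a₁ ^ 2 * b₁ * b₀ ^ 2 + A ^ 2 * a₁ ^ 2 *
    b₀ + 4 * A * a₁ * a₀ ^ 2 * b₁ ^ 2 - 3 * a₁ * a₀ ^ 2 * b₀ ^ 2 - 9 * B * a₁ * a₀ ^ 2 + 4 *
    A * a₁ * a₀ * b₁ ^ 2 * b₀ + 2 * A ^ 2 * a₁ * a₀ * b₁ + 6 * a₁ * a₀ * b₀ ^ 3 + 18 * B *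
    a₁ * a₀ * b₀ + 2 * A ^ 2 * a₁ * b₁ * b₀ + 9 * B * a₁ * b₀ ^ 2 + (4 * A ^ 3 + 27 * B ^ 2) *
    a₁ + 6 * a₀ ^ 3 * b₁ * b₀ + A * a₀ ^ 3 - 2 * A * a₀ ^ 2 * b₁ ^ 3 - 3 * a₀ ^ 2 * b₁ * b₀ ^
    2 + 9 * B * a₀ ^ 2 * b₁ - 9 * A * a₀ ^ 2 * b₀ + A ^ 2 * a₀ * b₁ ^ 2 + 18 * B * a₀ * b₁ *
    b₀ - 9 * A * a₀ * b₀ ^ 2 + 2 * A * B * b₁ ^ 3 - 3 * A ^ 2 * b₁ ^ 2 * b₀ - 9 * B * b₁ *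
    b₀ ^ 2 + (4 * A ^ 3 + 27 * B ^ 2) * b₁ + A * b₀ ^ 3

def sB0 (A B a₁ a₀ b₁ b₀ : F) : F :=
  -2 * A ^ 2 * a₁ ^ 3 * b₁ * b₀ - 8 * B * a₁ ^ 3 * b₀ ^ 2 + (A ^ 3 + 8 * B ^ 2) * a₁ ^ 3 + A ^
    2 * a₁ ^ 2 * a₀ * b₁ ^ 2 - 8 * B * a₁ ^ 2 * a₀ * b₁ * b₀ + 6 * A * a₁ ^ 2 * a₀ * b₀ ^ 2 -
    2 * A * B * a₁ ^ 2 * a₀ + A ^ 2 * a₁ ^ 2 * b₁ ^ 2 * b₀ + 4 * B * a₁ ^ 2 * b₁ * b₀ ^ 2 +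
    (-A ^ 3 - 12 * B ^ 2) * a₁ ^ 2 * b₁ + 4 * A * B * a₁ ^ 2 * b₀ + 4 * B * a₁ * a₀ ^ 2 * b₁ ^
    2 + A ^ 2 * a₁ * a₀ ^ 2 - 2 * A ^ 2 * a₁ * a₀ * b₁ ^ 3 - 8 * B * a₁ * a₀ * b₁ ^ 2 * b₀ +
    8 * A * B * a₁ * a₀ * b₁ - 6 * A ^ 2 * a₁ * a₀ * b₀ + (-A ^ 3 - 12 * B ^ 2) * a₁ * b₁ ^
    2 + 8 * A * B * a₁ * b₁ * b₀ - 3 * A ^ 2 * a₁ * b₀ ^ 2 + 3 * a₀ ^ 3 * b₀ ^ 2 + B * a₀ ^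
    3 - 8 * B * a₀ ^ 2 * b₁ ^ 3 + 6 * A * a₀ ^ 2 * b₁ ^ 2 * b₀ - 3 * A ^ 2 * a₀ ^ 2 * b₁ + 3 *
    a₀ ^ 2 * b₀ ^ 3 - 15 * B * a₀ ^ 2 * b₀ + 4 * A * B * a₀ * b₁ ^ 2 - 6 * A ^ 2 * a₀ * b₁ *
    b₀ - 15 * B * a₀ * b₀ ^ 2 + (4 * A ^ 3 + 27 * B ^ 2) * a₀ + (A ^ 3 + 8 * B ^ 2) * b₁ ^ 3 -
    2 * A * B * b₁ ^ 2 * b₀ + A ^ 2 * b₁ * b₀ ^ 2 + B * b₀ ^ 3 + (4 * A ^ 3 + 27 * B ^ 2) *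
    b₀

open Classical in
/-- The factor by which the explicit formulas are multiplied to make the second component of
`S_{Q,R}` monic (of degree three), if `b₃ ≠ 0`. (If `b₃ = 0`, then no scaling is done.) -/
def sScale (A B : F) (L L' : Line F) : F :=
  if sB3 A B L.a₁ L.a₀ L'.a₁ L'.a₀ = 0 then 1 else (sB3 A B L.a₁ L.a₀ L'.a₁ L'.a₀)⁻¹

/-- The pair `(S₁, S₂)` with `S_{Q,R} = S₁ + y S₂`, computed from the lines of `Q` and `R`. -/
def sPoly (A B : F) (L L' : Line F) : F[X] × F[X] :=
  (C (sScale A B L L') *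
      (C (sA4 A B L.a₁ L.a₀ L'.a₁ L'.a₀) * X ^ 4 + C (sA3 A B L.a₁ L.a₀ L'.a₁ L'.a₀) * X ^ 3 +
        C (sA2 A B L.a₁ L.a₀ L'.a₁ L'.a₀) * X ^ 2 + C (sA1 A B L.a₁ L.a₀ L'.a₁ L'.a₀) * X +
        C (sA0 A B L.a₁ L.a₀ L'.a₁ L'.a₀)),
    C (sScale A B L L') *
      (C (sB3 A B L.a₁ L.a₀ L'.a₁ L'.a₀) * X ^ 3 + C (sB2 A B L.a₁ L.a₀ L'.a₁ L'.a₀) * X ^ 2 +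
        C (sB1 A B L.a₁ L.a₀ L'.a₁ L'.a₀) * X + C (sB0 A B L.a₁ L.a₀ L'.a₁ L'.a₀)))

end Formulas

section Subalgorithm

variable {F : Type*} [Field F]

/-- `(g₁, g₀) = (L.a₁, L.a₀)` solves the linear system with the augmented matrix `L(W, S)`, where
`W = x³ + w₂x² + w₁x + w₀` and `S = (a₄x⁴ + … + a₀) + y (x³ + b₂x² + b₁x + b₀)`. -/
def SolvesSystem (W : F[X]) (S : F[X] × F[X]) (L : Line F) : Prop :=
  let w := W.coeff
  let a := S.1.coeff
  let b := S.2.coeff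
  w 0 * (w 2 - b 2) * L.a₁ + (b 0 - w 0) * L.a₀ = w 0 * a 3 - a 4 * w 2 * w 0 - a 0 ∧
  w 0 * (w 1 - b 1) * L.a₁ + (b 0 * w 2 - w 0 * b 2) * L.a₀ =
    w 0 * a 2 - a 4 * w 1 * w 0 - a 0 * w 2 ∧
  w 0 * (w 0 - b 0) * L.a₁ + (b 0 * w 1 - b 1 * w 0) * L.a₀ =
    w 0 * a 1 - a 4 * w 0 ^ 2 - a 0 * w 1

open Classical in
/-- The solution of the linear system `L(W, S)`. It fails if there is no solution, or if there are
several. -/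
def solveSystem (W : F[X]) (S : F[X] × F[X]) : Option (Line F) :=
  if h : ∃! L : Line F, SolvesSystem W S L then some h.choose else none

/-- The monic scalar multiple of a nonzero polynomial. -/
def toMonic (g : F[X]) : F[X] := C g.leadingCoeff⁻¹ * g

/-- `f S₂² - S₁²` for `S = S₁ + y S₂`. -/
def sigma (A B : F) (S : F[X] × F[X]) : F[X] := cubic A B * S.2 ^ 2 - S.1 ^ 2

open Classical in
/-- The distinct monic irreducible factors of degree three of `G`. -/
def cubicFactors (G : F[X]) : Finset F[X] :=
  (UniqueFactorizationMonoid.normalizedFactors G).toFinset.filter fun W => W.natDegree = 3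

open Classical in
/-- The final loop of the subalgorithm, over a list of polynomials `W`. -/
def factorLoop (S T : F[X] × F[X]) : List F[X] → Option (Line F)
  | [] => none
  | W :: Ws =>
    if W ≠ S.2 then
      match solveSystem W S with
      | none => none
      | some L =>
        if W ∣ (C L.a₁ * X + C L.a₀) * T.2 + T.1 then some L else factorLoop S T Ws
    else solveSystem W T

open Classical in
/-- Subalgorithm 1, with input the lines of `m₁P`, `m₂P`, `n₁P`, `n₂P`. The function `enum`
lists the elements of a finite set of polynomials in some order: it fixes the order in which the
final loop runs through the factors. The value `none` means that the algorithm fails. -/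
def subalg (enum : Finset F[X] → List F[X]) (A B : F) (M₁ M₂ N₁ N₂ : Line F) : Option (Line F) :=
  if M₁ = M₂ then some M₁.neg
  else if N₁ = N₂ then some N₁.neg
  else
    let S := sPoly A B M₁ M₂
    let T := sPoly A B N₁ N₂
    if M₁ = M₂.neg then solveSystem (toMonic S.1) T
    else if N₁ = N₂.neg then solveSystem (toMonic T.1) S
    else factorLoop S T (enum (cubicFactors (EuclideanDomain.gcd (sigma A B S) (sigma A B T))))

/-- Doubling, where the failure of an earlier computation is propagated. -/
def D (A B : F) (x : Option (Line F)) : Option (Line F) := x.bind (dbl A B)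

/-- Subalgorithm 1, where the failure of an earlier computation is propagated. -/
def Subalg (enum : Finset F[X] → List F[X]) (A B : F) (x₁ x₂ x₃ x₄ : Option (Line F)) :
    Option (Line F) :=
  x₁.bind fun L₁ => x₂.bind fun L₂ => x₃.bind fun L₃ => x₄.bind fun L₄ =>
    subalg enum A B L₁ L₂ L₃ L₄

end Subalgorithm

section Ladder

/-- The set `M` of exceptional residues modulo `p`. -/
def exceptional (p : ℕ) [Fact p.Prime] (s : ZMod p) : Set (ZMod p) :=
  {3 / (2 * s + 1), -3 / (2 * s + 1), (s - 4) / (3 * s), (4 * s - 1) / (2 * s + 1),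
    (s + 5) / (3 * (s + 1)), (4 * s + 5) / (2 * s + 1)}

/-- The set `ℳ` of the odd integers in `[0, p)` whose residue modulo `p` lies in `M`. -/
def oddExceptional (p : ℕ) [Fact p.Prime] (s : ZMod p) : Set ℕ :=
  {k | Odd k ∧ k < p ∧ (k : ZMod p) ∈ exceptional p s}

/-- The binary prefix `k_i = ∑_{j ≥ i} m_j 2^{j-i}` of `m = ∑_j m_j 2^j`. -/
def binPrefix (m i : ℕ) : ℕ := m / 2 ^ i

variable {F : Type*} [Field F] [Fintype F] {K : Type*} [Field K] [DecidableEq K] [Algebra F K]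
  {A B : F}

open Classical in
/-- The pair `(u_i, v_i)`, for `0 ≤ i < ℓ`, where `ℓ = m.size` is the number of binary digits of
`m`, and `m.testBit i` is the digit `m_i`. (For `i ≥ ℓ` nothing is computed.) -/
def ladder (enum : Finset F[X] → List F[X]) (P : Points K A B) (p : ℕ) [Fact p.Prime] (s : ZMod p)
    (m : ℕ) (i : ℕ) : Option (Line F) × Option (Line F) :=
  let h : ℤ → Option (Line F) := fun n => lineOf (n • P)
  if m.size ≤ i then (none, none)
  else if i + 1 = m.size then (h 1, h 2)
  else if i + 2 = m.size then
    if m.testBit i then (h 3, h 4) else (h 2, h 3)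
  else
    let u₁ := (ladder enum P p s m (i + 1)).1
    let v₁ := (ladder enum P p s m (i + 1)).2
    let u₂ := (ladder enum P p s m (i + 2)).1
    let v₂ := (ladder enum P p s m (i + 2)).2
    let u₃ := (ladder enum P p s m (i + 3)).1
    let v₃ := (ladder enum P p s m (i + 3)).2
    let w : Option (Line F) :=
      if binPrefix m i ∈ oddExceptional p s ∨ binPrefix m i + 1 ∈ oddExceptional p s then
        match m.testBit (i + 1), m.testBit (i + 2) with
        | true, true => Subalg enum A B (h 3) (D A B (D A B u₂)) (h 7) (D A B (D A B (D A B u₃)))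
        | true, false =>
          Subalg enum A B (h 3) (D A B (D A B (D A B u₃))) (h (-5)) (D A B (D A B (D A B v₃)))
        | false, true =>
          Subalg enum A B (h (-3)) (D A B (D A B (D A B v₃))) (h 5) (D A B (D A B (D A B u₃)))
        | false, false =>
          Subalg enum A B (h (-3)) (D A B (D A B v₂)) (h (-7)) (D A B (D A B (D A B v₃)))
      else Subalg enum A B (h 1) (D A B u₁) u₁ v₁
    if m.testBit i then (w, D A B v₁) else (D A B u₁, w)
termination_by m.size - i

end Ladder

end

end T3

/-! Sending `a : ZMod p` to `a • P` identifies the trace zero subgroup with `ZMod p`, and Frobenius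
becomes multiplication by `s`. The trace relation gives `s² + s + 1 = 0`, so `s` is a primitive cube
root of unity. Each nonzero `a` has an orbit `a, sa, s²a` of three points that never contains `-a`,
and the line of a point amounts to its orbit. The abscissa has a minimal polynomial of degree three,
which determines the orbit only up to sign.

Let `a` be conjugate to neither `b` nor `-b`. Inside the subgroup, the function `S` built from the
lines of `a` and `b` vanishes exactly on the orbits of `a + b`, `a + sb`, `a + s²b`. That it
vanishes there is the identity `s_eval_secant`. The norm `f S₂² - S₁²` is monic of degree 9, hence
equals the product of the three minimal polynomials (`sigma_eq_mul`), which leaves no room for other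
zeros (`sPoly_spec`). If `z` is a zero of `S` whose abscissa has minimal polynomial `W`, the line of
`z` is the unique one with `W ∣ S₁ + (γ₁x + γ₀) S₂`, unless `W = S₂`; the latter happens exactly
when `-z` is a zero as well. Now let `T` come from `c`, `d` with `c + d = a + b = t`. Apart from
nondegeneracy, the subalgorithm returns the line of `t` as soon as the orbit of `t` is the only one
common to the two triples of sums (`subalg_eq_some`).

What remains is arithmetic modulo `p`. In the general case, with pairs `(1, 2k)` and `(k, k + 1)`, a
further common orbit is a linear equation in `k` which forces `k = 1` or `2k + 1 ∈ M`
(`eisenstein_cases`). In the special case `t = α / β` comes from one of six pairs of Eisenstein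
integers. A further common orbit would make one of finitely many elements of norm between 1 and
10800 vanish modulo `p` (`special_relation`), which `p > 10800` forbids (`toZMod_ne_zero`). The
ladder is an induction along the binary prefixes of `m`. -/

namespace T3

/-! ### Polynomial identities behind the explicit formulas. -/

section Identities

variable {F : Type*} [Field F]

/-! `sShift` is the value of `S` at the point `(X, -Y)` of `y² = f`, in terms of `G = 3 X`,
`D = f'(X)`, the slopes `a, b` of the two lines and their heights `e, e'` above `(X, Y)`. The
summands without `G` and `D`, without `G`, linear in `G`, and of higher degree in `G` come first. -/

def sShift₀ (Y a e b e' : F) : F :=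
  -6 * Y * e ^ 2 * e' ^ 3 - 6 * Y * e ^ 3 * e' ^ 2 - 4 * Y ^ 2 * a * b ^ 2 * e ^ 2 * e' - 4 * Y
    ^ 2 * a ^ 2 * b * e * e' ^ 2 - 12 * Y ^ 2 * e * e' ^ 3 - 24 * Y ^ 2 * e ^ 2 * e' ^ 2 - 12 *
    Y ^ 2 * e ^ 3 * e' - 8 * Y ^ 3 * a * b ^ 2 * e ^ 2 - 8 * Y ^ 3 * a ^ 2 * b * e' ^ 2 + 8 * Y
    ^ 3 * a ^ 3 * e' ^ 2 + 8 * Y ^ 3 * b ^ 3 * e ^ 2 - 24 * Y ^ 3 * e * e' ^ 2 - 24 * Y ^ 3 * e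
    ^ 2 * e' - 8 * Y ^ 3 * e ^ 3 - 8 * Y ^ 3 * e' ^ 3 - 32 * Y ^ 4 * a * b ^ 2 * e + 16 * Y ^ 4
    * a * b ^ 2 * e' + 16 * Y ^ 4 * a ^ 2 * b * e - 32 * Y ^ 4 * a ^ 2 * b * e' + 16 * Y ^ 4 * a
    ^ 3 * e' + 16 * Y ^ 4 * b ^ 3 * e - e ^ 3 * e' ^ 3

def sShift₁ (Y D a e b e' : F) : F :=
  4 * D * Y * a * b * e * e' ^ 2 + 4 * D * Y * a * b * e ^ 2 * e' - 6 * D * Y * a ^ 2 * e * e' ^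
    2 - 6 * D * Y * b ^ 2 * e ^ 2 * e' + 32 * D * Y ^ 2 * a * b * e * e' - 16 * D * Y ^ 2 * a ^
    2 * e * e' - 16 * D * Y ^ 2 * b ^ 2 * e * e' + 16 * D * Y ^ 3 * a * b * e + 16 * D * Y ^ 3 *
    a * b * e' - 8 * D * Y ^ 3 * a ^ 2 * e - 8 * D * Y ^ 3 * a ^ 2 * e' - 8 * D * Y ^ 3 * b ^ 2
    * e - 8 * D * Y ^ 3 * b ^ 2 * e' + 2 * D * a * b * e ^ 2 * e' ^ 2 + 2 * D ^ 2 * Y * a * b ^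
    3 * e - 2 * D ^ 2 * Y * a * e * e' - 2 * D ^ 2 * Y * a * e ^ 2 - 2 * D ^ 2 * Y * a ^ 2 * b ^
    2 * e - 2 * D ^ 2 * Y * a ^ 2 * b ^ 2 * e' + 2 * D ^ 2 * Y * a ^ 3 * b * e' - 2 * D ^ 2 * Y
    * b * e * e' - 2 * D ^ 2 * Y * b * e' ^ 2 + 4 * D ^ 2 * Y ^ 2 * a * b ^ 3 - 8 * D ^ 2 * Y ^
    2 * a ^ 2 * b ^ 2 + 4 * D ^ 2 * Y ^ 2 * a ^ 3 * b - 3 * D ^ 2 * a * e * e' ^ 2 - D ^ 2 * a *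
    e ^ 2 * e' - D ^ 2 * a ^ 2 * b ^ 2 * e * e' - D ^ 2 * b * e * e' ^ 2 - 3 * D ^ 2 * b * e ^ 2
    * e' + 2 * D ^ 3 * Y * a * b ^ 2 + 2 * D ^ 3 * Y * a ^ 2 * b - 2 * D ^ 3 * Y * a ^ 3 - 2 * D
    ^ 3 * Y * b ^ 3 + D ^ 3 * a * b ^ 2 * e + D ^ 3 * a ^ 2 * b * e' - D ^ 3 * a ^ 3 * e' - D ^
    3 * b ^ 3 * e + 2 * D ^ 3 * e * e' + D ^ 3 * e ^ 2 + D ^ 3 * e' ^ 2 - 2 * D ^ 4 * a * b + D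
    ^ 4 * a ^ 2 + D ^ 4 * b ^ 2

def sShift₂ (Y D a e b e' : F) : F :=
  2 * D * Y * e * e' ^ 2 + 2 * D * Y * e ^ 2 * e' - 4 * D * Y ^ 2 * a * b ^ 2 * e - 4 * D * Y ^
    2 * a ^ 2 * b * e' + 4 * D * Y ^ 2 * a ^ 3 * e' + 4 * D * Y ^ 2 * b ^ 3 * e - 8 * D * Y ^ 2
    * e * e' - 4 * D * Y ^ 2 * e ^ 2 - 4 * D * Y ^ 2 * e' ^ 2 - 8 * D * Y ^ 3 * a * b ^ 2 - 8 *
    D * Y ^ 3 * a ^ 2 * b + 8 * D * Y ^ 3 * a ^ 3 + 8 * D * Y ^ 3 * b ^ 3 + 2 * D * e ^ 2 * e' ^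
    2 - 2 * D ^ 2 * Y * a * b * e - 2 * D ^ 2 * Y * a * b * e' + 2 * D ^ 2 * Y * a ^ 2 * e + 2 *
    D ^ 2 * Y * b ^ 2 * e' + 8 * D ^ 2 * Y ^ 2 * a * b - 4 * D ^ 2 * Y ^ 2 * a ^ 2 - 4 * D ^ 2 *
    Y ^ 2 * b ^ 2 + D ^ 2 * a ^ 2 * e * e' + D ^ 2 * b ^ 2 * e * e' - D ^ 3 * a * e + D ^ 3 * a
    * e' + D ^ 3 * b * e - D ^ 3 * b * e' + 4 * Y * a * e ^ 2 * e' ^ 2 + 4 * Y * b * e ^ 2 * e'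
    ^ 2 + 4 * Y ^ 2 * a * e * e' ^ 2 + 16 * Y ^ 2 * a * e ^ 2 * e' + 4 * Y ^ 2 * a ^ 2 * b ^ 2 *
    e * e' + 16 * Y ^ 2 * b * e * e' ^ 2 + 4 * Y ^ 2 * b * e ^ 2 * e' - 8 * Y ^ 3 * a * b ^ 3 *
    e + 8 * Y ^ 3 * a * e * e' + 16 * Y ^ 3 * a * e ^ 2 - 8 * Y ^ 3 * a * e' ^ 2 + 8 * Y ^ 3 * a
    ^ 2 * b ^ 2 * e + 8 * Y ^ 3 * a ^ 2 * b ^ 2 * e' - 8 * Y ^ 3 * a ^ 3 * b * e' + 8 * Y ^ 3 *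
    b * e * e' - 8 * Y ^ 3 * b * e ^ 2 + 16 * Y ^ 3 * b * e' ^ 2 - 16 * Y ^ 4 * a * b ^ 3 + 32 *
    Y ^ 4 * a ^ 2 * b ^ 2 - 16 * Y ^ 4 * a ^ 3 * b

def sShift₃ (G Y D a e b e' : F) : F :=
  4 * D * Y ^ 2 * a * e - 4 * D * Y ^ 2 * a * e' - 4 * D * Y ^ 2 * b * e + 4 * D * Y ^ 2 * b *
    e' - D ^ 2 * e * e' + 4 * G * Y ^ 2 * e * e' - 4 * Y ^ 2 * a ^ 2 * e * e' - 4 * Y ^ 2 * b ^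
    2 * e * e' + 8 * Y ^ 3 * a * b * e + 8 * Y ^ 3 * a * b * e' - 8 * Y ^ 3 * a ^ 2 * e - 8 * Y
    ^ 3 * b ^ 2 * e'

def sShift (G Y D a e b e' : F) : F :=
  sShift₀ Y a e b e' + sShift₁ Y D a e b e' + sShift₂ Y D a e b e' * G +
    sShift₃ G Y D a e b e' * G ^ 2

/-- Here `u`, `v` are the abscissas of the two points relative to the third point of their secant.
The sum of the three abscissas is `l²`, and differentiating `f - (lx + n)² = ∏ (x - xᵢ)` at `X`
gives `D = 2Yl + uv`. After substitution only a polynomial identity in free variables is left. -/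
theorem sShift_eq_zero {G Y D a e b e' l u v : F} (hG : G = l ^ 2 - u - v)
    (hD : D = 2 * Y * l + u * v) (he : e = (l - a) * u) (he' : e' = (l - b) * v) :
    sShift G Y D a e b e' = 0 := by
  subst hG hD he he'
  simp only [sShift, sShift₀, sShift₁, sShift₂, sShift₃]
  ring

/-- Moves the origin to the point: `A`, `B` are replaced by the value and the derivative of `f`
there, the constant terms of the lines by their heights above the point. This splits one very large
expansion into two smaller ones. -/
theorem s_eval_eq_sShift {A B a a₀ b b₀ x y D e e' : F} (hA : A = D - 3 * x ^ 2)
    (hB : B = y ^ 2 - D * x + 2 * x ^ 3) (ha₀ : a₀ = e + y - a * x) (hb₀ : b₀ = e' + y - b * x) :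
    (sA4 A B a a₀ b b₀ * x ^ 4 + sA3 A B a a₀ b b₀ * x ^ 3 + sA2 A B a a₀ b b₀ * x ^ 2 +
        sA1 A B a a₀ b b₀ * x + sA0 A B a a₀ b b₀) -
      y * (sB3 A B a a₀ b b₀ * x ^ 3 + sB2 A B a a₀ b b₀ * x ^ 2 +
        sB1 A B a a₀ b b₀ * x + sB0 A B a a₀ b b₀) = sShift (3 * x) y D a e b e' := by
  subst hA hB ha₀ hb₀
  simp only [sShift, sShift₀, sShift₁, sShift₂, sShift₃, sA4, sA3, sA2, sA1, sA0, sB3, sB2, sB1,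
    sB0]
  ring

/-- The explicit polynomial `S` vanishes at the sum of two points, one on each line. Here
`y = l x + n` is the secant through the two points, with abscissas `x₁` and `x₂`. -/
theorem s_eval_secant (x₁ x₂ l n : F) {A B a a₀ b b₀ x₃ : F} (h3 : x₃ = l ^ 2 - x₁ - x₂)
    (hA : A = x₁ * x₂ + x₁ * x₃ + x₂ * x₃ + 2 * l * n) (hB : B = n ^ 2 - x₁ * x₂ * x₃)
    (ha : a * x₁ + a₀ = l * x₁ + n) (hb : b * x₂ + b₀ = l * x₂ + n) :
    (sA4 A B a a₀ b b₀ * x₃ ^ 4 + sA3 A B a a₀ b b₀ * x₃ ^ 3 + sA2 A B a a₀ b b₀ * x₃ ^ 2 +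
        sA1 A B a a₀ b b₀ * x₃ + sA0 A B a a₀ b b₀) -
      (l * x₃ + n) * (sB3 A B a a₀ b b₀ * x₃ ^ 3 + sB2 A B a a₀ b b₀ * x₃ ^ 2 +
        sB1 A B a a₀ b b₀ * x₃ + sB0 A B a a₀ b b₀) = 0 := by
  have hl : l ^ 2 = x₁ + x₂ + x₃ := by linear_combination -h3
  -- A line of slope `a` that meets the secant at `x₁` lies `(l - a)(x₁ - x₃)` above it at `x₃`.
  rw [s_eval_eq_sShift (D := A + 3 * x₃ ^ 2) (e := (l - a) * (x₁ - x₃))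
    (e' := (l - b) * (x₂ - x₃)) (by ring) _ (by linear_combination ha) (by linear_combination hb)]
  · refine sShift_eq_zero (l := l) (u := x₁ - x₃) (v := x₂ - x₃) ?_ ?_ rfl rfl
    · linear_combination -hl
    · linear_combination hA - 2 * x₃ * hl
  · linear_combination hB + x₃ * hA - x₃ ^ 2 * hl

/-- The doubling formulas, for the tangent `y = l x + n` at the point with abscissa `x₁`. -/
theorem dbl_eval_tangent (x₁ l n c : F) {A B a a₀ x₃ : F} (h3 : x₃ = l ^ 2 - x₁ - x₁)
    (hA : A = x₁ * x₁ + x₁ * x₃ + x₁ * x₃ + 2 * l * n) (hB : B = n ^ 2 - x₁ * x₁ * x₃)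
    (ha : a = l - c) (ha₀ : a₀ = c * x₁ + n) :
    dblC A B a a₀ * -(l * x₃ + n) = dblU1 A B a a₀ * x₃ + dblU0 A B a a₀ := by
  subst h3
  subst hA hB ha ha₀
  simp only [dblC, dblU1, dblU0]
  ring

/-- The factors are the ordinates of the three points on the line, so the denominator of the
doubling vanishes only if one of them is 2-torsion. -/
theorem dblC_eq_prod {A B a a₀ r₁ r₂ r₃ : F} (h1 : r₁ + r₂ + r₃ = a ^ 2)
    (h2 : r₁ * r₂ + r₁ * r₃ + r₂ * r₃ = A - 2 * a * a₀) (h3 : r₁ * r₂ * r₃ = a₀ ^ 2 - B) :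
    dblC A B a a₀ = -8 * ((a * r₁ + a₀) * (a * r₂ + a₀) * (a * r₃ + a₀)) := by
  obtain rfl : A = r₁ * r₂ + r₁ * r₃ + r₂ * r₃ + 2 * a * a₀ := by linear_combination -h2
  obtain rfl : B = a₀ ^ 2 - r₁ * r₂ * r₃ := by linear_combination h3
  simp only [dblC]
  linear_combination (8 * a * a₀ ^ 2) * h1

/-- A factor vanishes exactly when the negated second line passes through the corresponding point of
the first one. -/
theorem sB3_eq_prod {A B a a₀ b b₀ r₁ r₂ r₃ : F} (h1 : r₁ + r₂ + r₃ = a ^ 2)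
    (h2 : r₁ * r₂ + r₁ * r₃ + r₂ * r₃ = A - 2 * a * a₀) (h3 : r₁ * r₂ * r₃ = a₀ ^ 2 - B) :
    sB3 A B a a₀ b b₀ = ((a + b) * r₁ + (a₀ + b₀)) * ((a + b) * r₂ + (a₀ + b₀)) *
      ((a + b) * r₃ + (a₀ + b₀)) := by
  obtain rfl : A = r₁ * r₂ + r₁ * r₃ + r₂ * r₃ + 2 * a * a₀ := by linear_combination -h2
  obtain rfl : B = a₀ ^ 2 - r₁ * r₂ * r₃ := by linear_combination h3
  simp only [sB3]
  linear_combination (-(a + b) * (a₀ + b₀) ^ 2) * h1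

theorem sA4_neg (A B a a₀ : F) : sA4 A B a a₀ (-a) (-a₀) = 0 := by simp only [sA4]; ring
theorem sB3_neg (A B a a₀ : F) : sB3 A B a a₀ (-a) (-a₀) = 0 := by simp only [sB3]; ring
theorem sB2_neg (A B a a₀ : F) : sB2 A B a a₀ (-a) (-a₀) = 0 := by simp only [sB2]; ring
theorem sB1_neg (A B a a₀ : F) : sB1 A B a a₀ (-a) (-a₀) = 0 := by simp only [sB1]; ring
theorem sB0_neg (A B a a₀ : F) : sB0 A B a a₀ (-a) (-a₀) = 0 := by simp only [sB0]; ring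

/-- For opposite lines `S` degenerates to a polynomial in `x` alone. Its cubic coefficient is minus
the discriminant of the roots, nonzero for three distinct conjugates. -/
theorem sA3_neg {A B a a₀ r₁ r₂ r₃ : F} (h1 : r₁ + r₂ + r₃ = a ^ 2)
    (h2 : r₁ * r₂ + r₁ * r₃ + r₂ * r₃ = A - 2 * a * a₀) (h3 : r₁ * r₂ * r₃ = a₀ ^ 2 - B) :
    sA3 A B a a₀ (-a) (-a₀) = -((r₁ - r₂) * (r₁ - r₃) * (r₂ - r₃)) ^ 2 := by
  have key : ((r₁ - r₂) * (r₁ - r₃) * (r₂ - r₃)) ^ 2 =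
      (r₁ + r₂ + r₃) ^ 2 * (r₁ * r₂ + r₁ * r₃ + r₂ * r₃) ^ 2 -
        4 * (r₁ * r₂ + r₁ * r₃ + r₂ * r₃) ^ 3 - 4 * (r₁ + r₂ + r₃) ^ 3 * (r₁ * r₂ * r₃) -
        27 * (r₁ * r₂ * r₃) ^ 2 +
        18 * (r₁ + r₂ + r₃) * (r₁ * r₂ + r₁ * r₃ + r₂ * r₃) * (r₁ * r₂ * r₃) := by
    ring
  rw [key, h1, h2, h3]
  simp only [sA3]
  ring

end Identities

/-! ### Coordinates, secants and tangents on the curve. -/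

section Coordinates

open WeierstrassCurve.Affine

variable {F : Type*} [Field F] {K : Type*} [Field K] [Algebra F K] {A B : F}

/-- The abscissa of an affine point. -/
def xCoord : Points K A B → K
  | .zero => 0
  | .some x _ _ => x

/-- The ordinate of an affine point. -/
def yCoord : Points K A B → K
  | .zero => 0
  | .some _ y _ => y

variable (K A B) in
theorem curve_coeffs : ((curve A B).baseChange K).toAffine.a₁ = 0 ∧
    ((curve A B).baseChange K).toAffine.a₂ = 0 ∧ ((curve A B).baseChange K).toAffine.a₃ = 0 ∧
    ((curve A B).baseChange K).toAffine.a₄ = algebraMap F K A := by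
  simp [curve]

theorem equation_iff (x y : K) : ((curve A B).baseChange K).toAffine.Equation x y ↔
    y ^ 2 = x ^ 3 + algebraMap F K A * x + algebraMap F K B := by
  rw [WeierstrassCurve.Affine.equation_iff]
  simp [curve]

theorem exists_eq_some {Z : Points K A B} (hZ : Z ≠ 0) :
    ∃ h, Z = .some (xCoord Z) (yCoord Z) h := by
  rcases Z with _ | ⟨x, y, h⟩
  · exact absurd rfl hZ
  · exact ⟨h, rfl⟩

theorem yCoord_sq {Z : Points K A B} (hZ : Z ≠ 0) : yCoord Z ^ 2 =
    xCoord Z ^ 3 + algebraMap F K A * xCoord Z + algebraMap F K B := by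
  obtain ⟨h, -⟩ := exists_eq_some hZ
  exact (equation_iff _ _).1 h.1

theorem xCoord_neg (Z : Points K A B) : xCoord (-Z) = xCoord Z := by
  rcases Z with _ | ⟨x, y, h⟩ <;> rfl

theorem yCoord_neg (Z : Points K A B) : yCoord (-Z) = -yCoord Z := by
  rcases Z with _ | ⟨x, y, h⟩
  · exact neg_zero.symm
  · change ((curve A B).baseChange K).toAffine.negY x y = -y
    simp [negY, curve]

theorem ext_coord {Z Z' : Points K A B} (hZ : Z ≠ 0) (hZ' : Z' ≠ 0) (hx : xCoord Z = xCoord Z')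
    (hy : yCoord Z = yCoord Z') : Z = Z' := by
  obtain ⟨h, e⟩ := exists_eq_some hZ
  obtain ⟨h', e'⟩ := exists_eq_some hZ'
  rw [e, e', Point.some.injEq]
  exact ⟨hx, hy⟩

variable [DecidableEq K]

theorem xCoord_eq_iff {Z Z' : Points K A B} (hZ : Z ≠ 0) (hZ' : Z' ≠ 0) :
    xCoord Z = xCoord Z' ↔ Z = Z' ∨ Z = -Z' := by
  constructor
  · intro hx
    have h : yCoord Z ^ 2 = yCoord Z' ^ 2 := by rw [yCoord_sq hZ, yCoord_sq hZ', hx]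
    rcases sq_eq_sq_iff_eq_or_eq_neg.1 h with h | h
    · exact .inl (ext_coord hZ hZ' hx h)
    · exact .inr (ext_coord hZ (neg_ne_zero.2 hZ') (by rw [hx, xCoord_neg]) (by rw [h, yCoord_neg]))
  · rintro (rfl | rfl)
    · rfl
    · rw [xCoord_neg]

/-- Vieta's relations for `f - (lx + n)²`, whose roots are the abscissas of the three points on the
secant. -/
theorem exists_secant {Q R : Points K A B} (hQ : Q ≠ 0) (hR : R ≠ 0)
    (hx : xCoord Q ≠ xCoord R) : ∃ l n : K, yCoord Q = l * xCoord Q + n ∧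
      yCoord R = l * xCoord R + n ∧ xCoord (Q + R) = l ^ 2 - xCoord Q - xCoord R ∧
      algebraMap F K A = xCoord Q * xCoord R + xCoord Q * xCoord (Q + R) +
        xCoord R * xCoord (Q + R) + 2 * l * n ∧
      algebraMap F K B = n ^ 2 - xCoord Q * xCoord R * xCoord (Q + R) ∧
      yCoord (Q + R) = -(l * xCoord (Q + R) + n) := by
  obtain ⟨c₁, c₂, c₃, c₄⟩ := curve_coeffs K A B
  have eQ := yCoord_sq hQ
  have eR := yCoord_sq hR
  obtain ⟨hQ', e⟩ := exists_eq_some hQ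
  obtain ⟨hR', e'⟩ := exists_eq_some hR
  have hs := Point.add_of_X_ne (h₁ := hQ') (h₂ := hR') hx
  have hl := slope_of_X_ne (W := ((curve A B).baseChange K).toAffine) (y₁ := yCoord Q)
    (y₂ := yCoord R) hx
  rw [← e, ← e'] at hs
  have hx3 := congrArg xCoord hs
  have hy3 := congrArg yCoord hs
  change xCoord (Q + R) = addX _ _ _ _ at hx3
  change yCoord (Q + R) = addY _ _ _ _ _ at hy3
  generalize slope (F := K) _ _ _ _ _ = l at hx3 hy3 hl
  simp only [addX, addY, negAddY, negY, c₁, c₂, c₃, zero_mul, sub_zero, add_zero] at hx3 hy3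
  have hd : xCoord Q - xCoord R ≠ 0 := sub_ne_zero.2 hx
  have hl' : l * (xCoord Q - xCoord R) = yCoord Q - yCoord R := by
    rw [hl]; exact div_mul_cancel₀ _ hd
  generalize xCoord (Q + R) = x₃ at *
  generalize yCoord (Q + R) = y₃ at *
  generalize xCoord Q = x₁ at *
  generalize xCoord R = x₂ at *
  generalize yCoord R = y₂ at *
  generalize yCoord Q = y₁ at *
  obtain ⟨n, hn⟩ : ∃ n, n = y₁ - l * x₁ := ⟨_, rfl⟩
  have h1 : y₁ = l * x₁ + n := by rw [hn]; ring
  have h2 : y₂ = l * x₂ + n := by rw [hn]; linear_combination hl'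
  -- The difference of the curve equations at the two points is `x₁ - x₂` times this relation.
  have hA : algebraMap F K A = x₁ * x₂ + x₁ * x₃ + x₂ * x₃ + 2 * l * n := by
    refine mul_right_cancel₀ hd ?_
    rw [h1] at eQ
    rw [h2] at eR
    rw [hx3]
    linear_combination eR - eQ
  refine ⟨l, n, h1, h2, hx3, hA, ?_, ?_⟩
  · rw [h1, hA] at eQ
    rw [hx3] at eQ ⊢
    linear_combination -eQ
  · rw [hy3, ← hx3, hn]
    ring

theorem exists_tangent (h2 : (2 : K) ≠ 0) {Q : Points K A B} (hQ : Q ≠ 0)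
    (hy : yCoord Q ≠ 0) : ∃ l n : K, yCoord Q = l * xCoord Q + n ∧ Q + Q ≠ 0 ∧
      xCoord (Q + Q) = l ^ 2 - xCoord Q - xCoord Q ∧
      algebraMap F K A = xCoord Q * xCoord Q + xCoord Q * xCoord (Q + Q) +
        xCoord Q * xCoord (Q + Q) + 2 * l * n ∧
      algebraMap F K B = n ^ 2 - xCoord Q * xCoord Q * xCoord (Q + Q) ∧
      yCoord (Q + Q) = -(l * xCoord (Q + Q) + n) := by
  obtain ⟨c₁, c₂, c₃, c₄⟩ := curve_coeffs K A B
  have eQ := yCoord_sq hQ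
  obtain ⟨hQ', e⟩ := exists_eq_some hQ
  have hyn : yCoord Q ≠ ((curve A B).baseChange K).toAffine.negY (xCoord Q) (yCoord Q) := by
    intro h
    simp [negY, curve] at h
    have : 2 * yCoord Q = 0 := by linear_combination h
    exact (mul_ne_zero h2 hy) this
  have hs := Point.add_self_of_Y_ne (h₁ := hQ') hyn
  have hl := slope_of_Y_ne (W := ((curve A B).baseChange K).toAffine) rfl hyn
  rw [← e] at hs
  have h0 : Q + Q ≠ 0 := by rw [hs]; exact Point.some_ne_zero _
  have hx3 := congrArg xCoord hs
  have hy3 := congrArg yCoord hs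
  change xCoord (Q + Q) = addX _ _ _ _ at hx3
  change yCoord (Q + Q) = addY _ _ _ _ _ at hy3
  generalize slope (F := K) _ _ _ _ _ = l at hx3 hy3 hl
  simp only [addX, addY, negAddY, negY, c₁, c₂, c₃, c₄, zero_mul, mul_zero, sub_zero, add_zero] at hx3 hy3 hl
  have hd : yCoord Q - -yCoord Q ≠ 0 := by
    rw [sub_neg_eq_add, ← two_mul]; exact mul_ne_zero h2 hy
  have hl' : l * (yCoord Q - -yCoord Q) = 3 * xCoord Q ^ 2 + algebraMap F K A := by
    rw [hl]; exact div_mul_cancel₀ _ hd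
  refine ⟨l, yCoord Q - l * xCoord Q, by ring, h0, hx3, ?_, ?_, ?_⟩
  · rw [hx3]
    linear_combination -hl'
  · rw [hx3]
    linear_combination -eQ + xCoord Q * hl'
  · rw [hy3, hx3]
    ring

end Coordinates

section

variable {F : Type*} [Field F] {K : Type*} [Field K] [Algebra F K]

theorem isIntegral_of_finrank (hK : Module.finrank F K = 3) (x : K) : IsIntegral F x :=
  have : Module.Finite F K := Module.finite_of_finrank_pos (by omega)
  .of_finite F x

theorem monic_cubic_sub (A B a b : F) : (cubic A B - (C a * X + C b) ^ 2).Monic ∧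
    (cubic A B - (C a * X + C b) ^ 2).natDegree = 3 := by
  have h : cubic A B - (C a * X + C b) ^ 2 =
      C 1 * X ^ 3 + C (-a ^ 2) * X ^ 2 + C (A - 2 * a * b) * X + C (B - b ^ 2) := by
    simp only [cubic, C_1, C_neg, C_sub, C_mul, C_pow, C_ofNat]
    ring
  rw [h]
  exact ⟨by rw [Monic, leadingCoeff_cubic one_ne_zero], natDegree_cubic one_ne_zero⟩

end

/-! ### Frobenius orbits and the lines through them. -/

section Frobenius

variable {F : Type*} [Field F] [Fintype F] {K : Type*} [Field K] [Algebra F K] {A B : F}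

/-- `X ^ q - X` has at most `q` roots, and `F` already supplies `q` of them. -/
theorem mem_range_of_pow_card_eq {x : K} (hx : x ^ Fintype.card F = x) :
    ∃ a : F, algebraMap F K a = x := by
  classical
  by_contra! h
  let s : Finset K := Finset.univ.image (algebraMap F K)
  have hs : x ∉ s := by simpa [s] using h
  have h1 : 1 < Fintype.card F := Fintype.one_lt_card
  have hc : (insert x s).card = Fintype.card F + 1 := by
    rw [Finset.card_insert_of_notMem hs, Finset.card_image_of_injective _ (algebraMap F K).injective,
      Finset.card_univ]
  have hsub : (insert x s).val ⊆ (X ^ Fintype.card F - X : K[X]).roots := by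
    intro y hy
    rw [mem_roots (FiniteField.X_pow_card_sub_X_ne_zero K h1)]
    rw [Finset.mem_val] at hy
    rcases Finset.mem_insert.1 hy with rfl | hy
    · simp [hx]
    · obtain ⟨a, -, rfl⟩ := Finset.mem_image.1 hy
      simp [← map_pow, FiniteField.pow_card]
  have := card_le_degree_of_subset_roots hsub
  rw [FiniteField.X_pow_card_sub_X_natDegree_eq K h1, hc] at this
  omega

theorem pow_card_injective : Function.Injective fun x : K => x ^ Fintype.card F :=
  (FiniteField.frobeniusAlgHom F K).toRingHom.injective

theorem pow_card_cube (hK : Module.finrank F K = 3) (x : K) :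
    x ^ Fintype.card F ^ 3 = x := by
  have : Module.Finite F K := Module.finite_of_finrank_pos (by omega)
  have : Finite K := Module.finite_of_finite F
  have := Fintype.ofFinite K
  rw [← hK, ← Module.card_eq_pow_finrank, FiniteField.pow_card]

theorem aeval_pow_card (G : F[X]) (x : K) :
    aeval (x ^ Fintype.card F) G = aeval x G ^ Fintype.card F :=
  aeval_algHom_apply (FiniteField.frobeniusAlgHom F K) x G

theorem pow_card_sq_ne (hK : Module.finrank F K = 3) {x : K} (hx : x ^ Fintype.card F ≠ x) :
    x ^ Fintype.card F ^ 2 ≠ x := by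
  intro h
  apply hx
  conv_rhs => rw [← pow_card_cube hK x, pow_succ, pow_mul, h]

/-- A monic cubic over `F` with a root `x ∈ K`, `x ∉ F`, has the conjugates of `x` as its roots. -/
theorem map_eq_prod_of_aeval_eq_zero (hK : Module.finrank F K = 3) {x : K}
    (hx : x ^ Fintype.card F ≠ x) {G : F[X]} (hG : G.Monic) (hd : G.natDegree = 3)
    (h0 : aeval x G = 0) : G.map (algebraMap F K) =
      (X - C x) * (X - C (x ^ Fintype.card F)) * (X - C (x ^ Fintype.card F ^ 2)) := by
  have h1 : aeval (x ^ Fintype.card F) G = 0 := by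
    rw [aeval_pow_card, h0, zero_pow Fintype.card_ne_zero]
  have h2 : aeval (x ^ Fintype.card F ^ 2) G = 0 := by
    rw [sq, pow_mul, aeval_pow_card, h1, zero_pow Fintype.card_ne_zero]
  have hx2 := pow_card_sq_ne hK hx
  have hx12 : x ^ Fintype.card F ≠ x ^ Fintype.card F ^ 2 := by
    intro h
    rw [sq, pow_mul] at h
    exact hx (pow_card_injective (F := F) h).symm
  have cop : ∀ {u v : K}, u ≠ v → IsCoprime (X - C u) (X - C v) := fun h =>
    isCoprime_X_sub_C_of_isUnit_sub (sub_ne_zero.2 h).isUnit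
  have dvd : ∀ {u : K}, aeval u G = 0 → X - C u ∣ G.map (algebraMap F K) := fun h => by
    rw [dvd_iff_isRoot, IsRoot.def, eval_map_algebraMap, h]
  refine eq_of_monic_of_dvd_of_natDegree_le
    (((monic_X_sub_C _).mul (monic_X_sub_C _)).mul (monic_X_sub_C _)) (hG.map _) ?_ ?_
  · exact (IsCoprime.mul_left (cop hx2.symm) (cop hx12)).mul_dvd
      ((cop hx.symm).mul_dvd (dvd h0) (dvd h1)) (dvd h2)
  · rw [natDegree_map, hd, ((monic_X_sub_C _).mul (monic_X_sub_C _)).natDegree_mul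
      (monic_X_sub_C _), (monic_X_sub_C _).natDegree_mul (monic_X_sub_C _), natDegree_X_sub_C,
      natDegree_X_sub_C, natDegree_X_sub_C]

theorem natDegree_minpoly_eq_three (hK : Module.finrank F K = 3) {x : K}
    (hx : x ^ Fintype.card F ≠ x) : (minpoly F x).natDegree = 3 := by
  have : Module.Finite F K := Module.finite_of_finrank_pos (by omega)
  have hi : IsIntegral F x := .of_finite F x
  have h := minpoly.degree_dvd hi
  rw [hK] at h
  rcases (Nat.dvd_prime Nat.prime_three).1 h with h | h
  · obtain ⟨a, rfl⟩ := minpoly.natDegree_eq_one_iff.1 h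
    exact absurd (by rw [← map_pow, FiniteField.pow_card]) hx
  · exact h

theorem ne_zero_of_xCoord_ne {Z : Points K A B} (hx : xCoord Z ^ Fintype.card F ≠ xCoord Z) :
    Z ≠ 0 := by
  rintro rfl
  exact hx (zero_pow Fintype.card_ne_zero)

theorem IsLineOf.mem {L : Line F} {Z : Points K A B} (h : IsLineOf L Z) : Z ≠ 0 ∧
    yCoord Z = algebraMap F K L.a₁ * xCoord Z + algebraMap F K L.a₀ := by
  obtain ⟨x, y, h, rfl, hy, -⟩ := h
  exact ⟨WeierstrassCurve.Affine.Point.some_ne_zero _, hy⟩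

theorem IsLineOf.map_eq {L : Line F} {Z : Points K A B} (h : IsLineOf L Z) :
    (cubic A B - (C L.a₁ * X + C L.a₀) ^ 2).map (algebraMap F K) =
      (X - C (xCoord Z)) * (X - C (xCoord Z ^ Fintype.card F)) *
        (X - C (xCoord Z ^ Fintype.card F ^ 2)) := by
  obtain ⟨x, y, h, rfl, -, hf⟩ := h
  exact hf

theorem isLineOf_of_mem (hK : Module.finrank F K = 3) {L : Line F} {Z : Points K A B}
    (hZ : Z ≠ 0) (hx : xCoord Z ^ Fintype.card F ≠ xCoord Z)
    (hy : yCoord Z = algebraMap F K L.a₁ * xCoord Z + algebraMap F K L.a₀) : IsLineOf L Z := by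
  obtain ⟨h, e⟩ := exists_eq_some hZ
  refine ⟨_, _, h, e, hy, map_eq_prod_of_aeval_eq_zero hK hx (monic_cubic_sub _ _ _ _).1
    (monic_cubic_sub _ _ _ _).2 ?_⟩
  simp only [cubic, map_sub, map_add, map_mul, map_pow, aeval_X, aeval_C, ← hy, yCoord_sq hZ]
  ring

theorem IsLineOf.neg (hK : Module.finrank F K = 3) {L : Line F} {Z : Points K A B}
    (hx : xCoord Z ^ Fintype.card F ≠ xCoord Z) (h : IsLineOf L Z) : IsLineOf L.neg (-Z) := by
  classical
  refine isLineOf_of_mem hK (neg_ne_zero.2 h.mem.1) (by rwa [xCoord_neg]) ?_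
  rw [yCoord_neg, xCoord_neg, h.mem.2, Line.neg, map_neg, map_neg]
  ring

variable [DecidableEq K]

theorem xCoord_frob (Z : Points K A B) : xCoord (frob Z) = xCoord Z ^ Fintype.card F := by
  rcases Z with _ | ⟨x, y, h⟩
  · exact (zero_pow Fintype.card_ne_zero).symm
  · rfl

theorem yCoord_frob (Z : Points K A B) : yCoord (frob Z) = yCoord Z ^ Fintype.card F := by
  rcases Z with _ | ⟨x, y, h⟩
  · exact (zero_pow Fintype.card_ne_zero).symm
  · rfl

theorem frob_injective : Function.Injective (frob : Points K A B → Points K A B) :=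
  WeierstrassCurve.Affine.Point.map_injective _

/-- Every affine point of the trace zero subgroup whose abscissa is not in `F` has a line. -/
theorem exists_isLineOf (hK : Module.finrank F K = 3) {Z : Points K A B}
    (hZ : Z ∈ traceZero K A B) (hx : xCoord Z ^ Fintype.card F ≠ xCoord Z) :
    ∃ L : Line F, IsLineOf L Z := by
  have hZ0 := ne_zero_of_xCoord_ne hx
  have hf0 : frob Z ≠ 0 := (map_ne_zero_iff _ frob_injective).2 hZ0
  -- The third point of the secant through `Z` and `φ(Z)` is therefore `φ²(Z)`.
  have hsum : Z + frob Z = -frob (frob Z) := eq_neg_of_add_eq_zero_left hZ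
  obtain ⟨l, n, h1, h2, -, -, -, h3⟩ := exists_secant hZ0 hf0 (by rw [xCoord_frob]; exact hx.symm)
  rw [hsum, xCoord_neg, yCoord_neg, neg_inj] at h3
  -- Frobenius carries the secant to a line through `φ(Z)` and `φ²(Z)`. That is the same line, so
  -- its coefficients are fixed by Frobenius and lie in `F`.
  have e1 : yCoord (frob Z) = l ^ Fintype.card F * xCoord (frob Z) + n ^ Fintype.card F := by
    rw [yCoord_frob, h1, xCoord_frob]
    exact (map_add (FiniteField.frobeniusAlgHom F K) _ _).trans (by rw [map_mul]; rfl)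
  have e2 : yCoord (frob (frob Z)) =
      l ^ Fintype.card F * xCoord (frob (frob Z)) + n ^ Fintype.card F := by
    rw [yCoord_frob (frob Z), h2, xCoord_frob (frob Z)]
    exact (map_add (FiniteField.frobeniusAlgHom F K) _ _).trans (by rw [map_mul]; rfl)
  have hne : xCoord (frob Z) - xCoord (frob (frob Z)) ≠ 0 := by
    rw [sub_ne_zero, xCoord_frob, xCoord_frob, xCoord_frob]
    exact fun h => hx (pow_card_injective (F := F) h).symm
  have hl : l ^ Fintype.card F = l := by
    refine mul_right_cancel₀ hne ?_
    linear_combination e2 - e1 + h2 - h3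
  have hn : n ^ Fintype.card F = n := by
    rw [hl] at e1
    linear_combination h2 - e1
  obtain ⟨a, rfl⟩ := mem_range_of_pow_card_eq hl
  obtain ⟨b, rfl⟩ := mem_range_of_pow_card_eq hn
  exact ⟨⟨a, b⟩, isLineOf_of_mem hK hZ0 hx h1⟩

theorem IsLineOf.frob (hK : Module.finrank F K = 3) {L : Line F} {Z : Points K A B}
    (hx : xCoord Z ^ Fintype.card F ≠ xCoord Z) (h : IsLineOf L Z) : IsLineOf L (frob Z) := by
  refine isLineOf_of_mem hK ((map_ne_zero_iff _ frob_injective).2 h.mem.1) ?_ ?_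
  · rw [xCoord_frob]
    exact fun h => hx (pow_card_injective (F := F) h)
  · rw [yCoord_frob, xCoord_frob, h.mem.2]
    refine (map_add (FiniteField.frobeniusAlgHom F K) _ _).trans ?_
    rw [map_mul, AlgHom.commutes, AlgHom.commutes]
    rfl

/-- Two points with the same line are conjugate. -/
theorem IsLineOf.eq_or {L : Line F} {Z Z' : Points K A B} (h : IsLineOf L Z)
    (h' : IsLineOf L Z') : Z' = Z ∨ Z' = T3.frob Z ∨ Z' = T3.frob (T3.frob Z) := by
  have h0 := congrArg (eval (xCoord Z')) (h.map_eq.symm.trans h'.map_eq)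
  simp only [eval_mul, eval_sub, eval_X, eval_C, sub_self, zero_mul, mul_eq_zero, sub_eq_zero,
    or_assoc] at h0
  -- The line has coefficients in `F`, so it determines the ordinate from the abscissa compatibly
  -- with Frobenius.
  have key : ∀ n : ℕ, xCoord Z' = xCoord Z ^ Fintype.card F ^ n →
      yCoord Z' = yCoord Z ^ Fintype.card F ^ n := by
    intro n hn
    rw [h'.mem.2, h.mem.2, hn]
    have e := map_add ((FiniteField.frobeniusAlgHom F K) ^ n)
      (algebraMap F K L.a₁ * xCoord Z) (algebraMap F K L.a₀)
    have e' : ∀ x : K, ((FiniteField.frobeniusAlgHom F K) ^ n) x = x ^ Fintype.card F ^ n := by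
      intro x
      rw [AlgHom.coe_pow, FiniteField.coe_frobeniusAlgHom, pow_iterate]
    rw [map_mul, AlgHom.commutes, AlgHom.commutes, e', e'] at e
    exact e.symm
  have hf : T3.frob Z ≠ 0 := (map_ne_zero_iff _ frob_injective).2 h.mem.1
  have hff : T3.frob (T3.frob Z) ≠ 0 := (map_ne_zero_iff _ frob_injective).2 hf
  rcases h0 with h0 | h0 | h0
  · exact .inl (ext_coord h'.mem.1 h.mem.1 h0 (by simpa using key 0 (by simpa using h0)))
  · exact .inr (.inl (ext_coord h'.mem.1 hf (by rw [h0, xCoord_frob])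
      (by rw [yCoord_frob]; simpa using key 1 (by simpa using h0))))
  · exact .inr (.inr (ext_coord h'.mem.1 hff
      (by rw [h0, xCoord_frob, xCoord_frob, ← pow_mul, sq])
      (by rw [yCoord_frob, yCoord_frob, ← pow_mul, ← sq]; exact key 2 h0)))

/-- Points with the same minimal polynomial are conjugate up to sign. -/
theorem eq_or_of_minpoly_eq (hK : Module.finrank F K = 3) {Z Z' : Points K A B} (hZ' : Z' ≠ 0)
    (hx : xCoord Z ^ Fintype.card F ≠ xCoord Z)
    (h : minpoly F (xCoord Z) = minpoly F (xCoord Z')) :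
    (Z' = Z ∨ Z' = T3.frob Z ∨ Z' = T3.frob (T3.frob Z)) ∨
      (Z' = -Z ∨ Z' = -T3.frob Z ∨ Z' = -T3.frob (T3.frob Z)) := by
  have hm := map_eq_prod_of_aeval_eq_zero hK hx (minpoly.monic (isIntegral_of_finrank hK _))
    (natDegree_minpoly_eq_three hK hx) (minpoly.aeval F (xCoord Z))
  have h0 := congrArg (eval (xCoord Z')) hm
  rw [h, eval_map_algebraMap, minpoly.aeval] at h0
  have h0 := h0.symm
  simp only [eval_mul, eval_sub, eval_X, eval_C, mul_eq_zero, sub_eq_zero, or_assoc] at h0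
  have hZ := ne_zero_of_xCoord_ne hx
  have hf : T3.frob Z ≠ 0 := (map_ne_zero_iff _ frob_injective).2 hZ
  have hff : T3.frob (T3.frob Z) ≠ 0 := (map_ne_zero_iff _ frob_injective).2 hf
  rcases h0 with h0 | h0 | h0
  · have := (xCoord_eq_iff hZ' hZ).1 h0
    tauto
  · have := (xCoord_eq_iff hZ' hf).1 (by rw [h0, xCoord_frob])
    tauto
  · have := (xCoord_eq_iff hZ' hff).1 (by rw [h0, xCoord_frob, xCoord_frob, ← pow_mul, sq])
    tauto

end Frobenius

/-! ### The trace zero subgroup as `ZMod p`, with Frobenius as multiplication by `s`. -/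

/-- `b` is `s ^ i * a` for some `i`. -/
def Conj {R : Type*} [Monoid R] (s a b : R) : Prop := ∃ i : ℕ, b = s ^ i * a

theorem intCast_zmod_ne_zero {p : ℕ} {n : ℤ} (h0 : n ≠ 0) (h : n.natAbs < p) :
    (n : ZMod p) ≠ 0 := by
  rw [Ne, ZMod.intCast_zmod_eq_zero_iff_dvd]
  intro hd
  have := Int.natAbs_dvd_natAbs.2 hd
  rw [Int.natAbs_natCast] at this
  exact absurd (Nat.le_of_dvd (Int.natAbs_pos.2 h0) this) (by omega)

section Param

variable {F : Type*} [Field F] [Fintype F] {K : Type*} [Field K] [DecidableEq K] [Algebra F K]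
  {A B : F}

/-- `pt` parametrizes the trace zero subgroup by `ZMod p`, with Frobenius acting as `s`. -/
structure Param (p : ℕ) (s : ZMod p) (pt : ZMod p →+ Points K A B) : Prop where
  finrank : Module.finrank F K = 3
  two_ne : (2 : K) ≠ 0
  prime : p.Prime
  large : 10800 < p
  inj : Function.Injective pt
  map_frob : ∀ a, frob (pt a) = pt (s * a)
  rel : s ^ 2 + s + 1 = 0

variable {p : ℕ} {s : ZMod p} {pt : ZMod p →+ Points K A B}

namespace Param

theorem cube (H : Param p s pt) : s ^ 3 = 1 := by linear_combination (s - 1) * H.rel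

theorem int_ne (H : Param p s pt) (n : ℤ) (h0 : n ≠ 0) (h : n.natAbs ≤ 10800) :
    (n : ZMod p) ≠ 0 :=
  intCast_zmod_ne_zero h0 (h.trans_lt H.large)

theorem two_ne' (H : Param p s pt) : (2 : ZMod p) ≠ 0 := by
  exact_mod_cast H.int_ne 2 (by norm_num) (by norm_num)

theorem three_ne (H : Param p s pt) : (3 : ZMod p) ≠ 0 := by
  exact_mod_cast H.int_ne 3 (by norm_num) (by norm_num)

theorem one_ne (H : Param p s pt) : (1 : ZMod p) ≠ 0 := by
  exact_mod_cast H.int_ne 1 (by norm_num) (by norm_num)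

theorem mul_eq_zero' (H : Param p s pt) {a b : ZMod p} (h : a * b = 0) : a = 0 ∨ b = 0 :=
  have : Fact p.Prime := ⟨H.prime⟩
  mul_eq_zero.1 h

theorem s_ne (H : Param p s pt) : s ≠ 0 := by
  rintro rfl
  exact H.one_ne (by simpa using H.rel)

theorem pow_s_ne (H : Param p s pt) (i : ℕ) : s ^ i ≠ 0 :=
  have : Fact p.Prime := ⟨H.prime⟩
  pow_ne_zero _ H.s_ne

theorem pt_ne (H : Param p s pt) {a : ZMod p} (ha : a ≠ 0) : pt a ≠ 0 :=
  (map_ne_zero_iff pt H.inj).2 ha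

/-- A fixed abscissa means that Frobenius sends the point to itself or its negative, so `s = ±1`;
then `s² + s + 1` is 3 or 1, not 0. -/
theorem moving (H : Param p s pt) {a : ZMod p} (ha : a ≠ 0) :
    xCoord (pt a) ^ Fintype.card F ≠ xCoord (pt a) := by
  have : Fact p.Prime := ⟨H.prime⟩
  rw [← xCoord_frob, H.map_frob]
  intro h
  have hs := H.rel
  rcases (xCoord_eq_iff (H.pt_ne (mul_ne_zero H.s_ne ha)) (H.pt_ne ha)).1 h with h | h
  · have h1 : s = 1 := mul_right_cancel₀ ha (by rw [one_mul]; exact H.inj h)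
    rw [h1] at hs
    exact H.three_ne (by linear_combination hs)
  · rw [← map_neg] at h
    have h1 : s = -1 := mul_right_cancel₀ ha (by rw [neg_one_mul]; exact H.inj h)
    rw [h1] at hs
    exact H.one_ne (by linear_combination hs)

theorem mem_traceZero (H : Param p s pt) (a : ZMod p) : pt a ∈ traceZero K A B := by
  change pt a + frob (pt a) + frob (frob (pt a)) = 0
  rw [H.map_frob, H.map_frob, ← map_add, ← map_add]
  have : a + s * a + s * (s * a) = 0 := by linear_combination a * H.rel
  rw [this, map_zero]

theorem exists_line (H : Param p s pt) {a : ZMod p} (ha : a ≠ 0) :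
    ∃ L : Line F, IsLineOf L (pt a) :=
  exists_isLineOf H.finrank (H.mem_traceZero a) (H.moving ha)

theorem _root_.T3.yCoord_ne_zero' {Z : Points K A B} (hZ : Z ≠ -Z) (h0 : Z ≠ 0) :
    yCoord Z ≠ 0 := fun h =>
  hZ (ext_coord h0 (neg_ne_zero.2 h0) (xCoord_neg Z).symm (by rw [yCoord_neg, h, neg_zero]))

theorem ne_zero_of_line (_H : Param p s pt) {a : ZMod p} {L : Line F} (h : IsLineOf L (pt a)) :
    a ≠ 0 := by
  rintro rfl
  exact h.mem.1 (map_zero pt)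

theorem ne_neg (H : Param p s pt) {a : ZMod p} (ha : a ≠ 0) : a ≠ -a := fun h =>
  (H.mul_eq_zero' (by linear_combination h : 2 * a = 0)).elim H.two_ne' ha

theorem y_ne (H : Param p s pt) {a : ZMod p} (ha : a ≠ 0) : yCoord (pt a) ≠ 0 := by
  refine T3.yCoord_ne_zero' ?_ (H.pt_ne ha)
  rw [← map_neg]
  exact fun h => H.ne_neg ha (H.inj h)

theorem conj_iff (H : Param p s pt) {a b : ZMod p} :
    Conj s a b ↔ b = a ∨ b = s * a ∨ b = s ^ 2 * a := by
  constructor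
  · rintro ⟨i, rfl⟩
    have hi : s ^ i = s ^ (i % 3) := by
      conv_lhs => rw [← Nat.div_add_mod i 3, pow_add, pow_mul, H.cube, one_pow, one_mul]
    rw [hi]
    have : i % 3 < 3 := Nat.mod_lt _ (by norm_num)
    interval_cases i % 3 <;> simp
  · rintro (rfl | rfl | rfl)
    · exact ⟨0, by simp⟩
    · exact ⟨1, by simp⟩
    · exact ⟨2, rfl⟩

theorem conj_symm (H : Param p s pt) {a b : ZMod p} (h : Conj s a b) : Conj s b a := by
  obtain ⟨i, rfl⟩ := h
  exact ⟨2 * i, by rw [← mul_assoc, ← pow_add, show 2 * i + i = 3 * i by ring, pow_mul, H.cube,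
    one_pow, one_mul]⟩

theorem _root_.T3.Conj.trans {R : Type*} [Monoid R] {s a b c : R} (h : Conj s a b)
    (h' : Conj s b c) : Conj s a c := by
  obtain ⟨i, rfl⟩ := h
  obtain ⟨j, rfl⟩ := h'
  exact ⟨j + i, by rw [pow_add, mul_assoc]⟩

theorem _root_.T3.Conj.neg {R : Type*} [Ring R] {s a b : R} (h : Conj s a b) :
    Conj s (-a) (-b) := by
  obtain ⟨i, rfl⟩ := h
  exact ⟨i, by rw [mul_neg]⟩

/-- Powers of `s` have cube 1, whereas `(-1)³ ≠ 1` for odd `p`. -/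
theorem not_conj_neg (H : Param p s pt) {a : ZMod p} (ha : a ≠ 0) : ¬ Conj s a (-a) := by
  rintro ⟨i, h⟩
  have : Fact p.Prime := ⟨H.prime⟩
  have h1 : s ^ i = -1 := mul_right_cancel₀ ha (by rw [neg_one_mul]; exact h.symm)
  have h3 : (s ^ i) ^ 3 = 1 := by rw [← pow_mul, mul_comm, pow_mul, H.cube, one_pow]
  rw [h1] at h3
  exact H.two_ne' (by linear_combination -h3)

theorem frob_iter_line (H : Param p s pt) {a b : ZMod p} {L : Line F} (h : IsLineOf L (pt a))
    (hab : Conj s a b) : IsLineOf L (pt b) := by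
  obtain ⟨i, rfl⟩ := hab
  have : Fact p.Prime := ⟨H.prime⟩
  induction i with
  | zero => simpa using h
  | succ i ih =>
    rw [pow_succ', mul_assoc, ← H.map_frob]
    exact ih.frob H.finrank (H.moving (H.ne_zero_of_line ih))

theorem conj_of_line (H : Param p s pt) {a b : ZMod p} {L : Line F} (h : IsLineOf L (pt a))
    (h' : IsLineOf L (pt b)) : Conj s a b := by
  rw [H.conj_iff]
  rcases h.eq_or h' with e | e | e
  · exact .inl (H.inj e)
  · rw [H.map_frob] at e
    exact .inr (.inl (H.inj e))
  · rw [H.map_frob, H.map_frob, ← mul_assoc, ← sq] at e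
    exact .inr (.inr (H.inj e))

theorem line_unique (H : Param p s pt) (h2 : ringChar F ≠ 2) {a b : ZMod p} {L L' : Line F}
    (h : IsLineOf L (pt a)) (h' : IsLineOf L' (pt b)) (hab : Conj s a b) : L = L' :=
  (H.frob_iter_line h hab).unique h2 h'

theorem line_neg (H : Param p s pt) {a : ZMod p} {L : Line F} (h : IsLineOf L (pt a)) :
    IsLineOf L.neg (pt (-a)) := by
  rw [map_neg]
  exact h.neg H.finrank (H.moving (H.ne_zero_of_line h))

theorem minpoly_conj (H : Param p s pt) {a b : ZMod p} (hab : Conj s a b) :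
    minpoly F (xCoord (pt b)) = minpoly F (xCoord (pt a)) := by
  obtain ⟨i, rfl⟩ := hab
  induction i with
  | zero => simp
  | succ i ih =>
    rw [pow_succ', mul_assoc, ← H.map_frob, xCoord_frob, ← ih]
    exact minpoly.algHom_eq (FiniteField.frobeniusAlgHom F K) (pow_card_injective (F := F)) _

theorem conj_of_minpoly (H : Param p s pt) {a b : ZMod p} (ha : a ≠ 0) (hb : b ≠ 0)
    (h : minpoly F (xCoord (pt a)) = minpoly F (xCoord (pt b))) :
    Conj s a b ∨ Conj s a (-b) := by
  rw [H.conj_iff, H.conj_iff]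
  have := eq_or_of_minpoly_eq H.finrank (H.pt_ne hb) (H.moving ha) h
  simp only [H.map_frob, ← map_neg, H.inj.eq_iff, ← mul_assoc, ← sq] at this
  simpa only [neg_eq_iff_eq_neg] using this

theorem irreducible_minpoly (H : Param p s pt) (a : ZMod p) :
    Irreducible (minpoly F (xCoord (pt a))) :=
  minpoly.irreducible (isIntegral_of_finrank H.finrank _)

theorem monic_minpoly (H : Param p s pt) (a : ZMod p) : (minpoly F (xCoord (pt a))).Monic :=
  minpoly.monic (isIntegral_of_finrank H.finrank _)

theorem natDegree_minpoly (H : Param p s pt) {a : ZMod p} (ha : a ≠ 0) :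
    (minpoly F (xCoord (pt a))).natDegree = 3 :=
  natDegree_minpoly_eq_three H.finrank (H.moving ha)

end Param

/-! ### Zeros of functions `S₁ + y S₂`. -/

/-- The function `S₁ + y S₂` vanishes at `Z`. -/
def VanishesAt (S : F[X] × F[X]) (Z : Points K A B) : Prop :=
  aeval (xCoord Z) S.1 + yCoord Z * aeval (xCoord Z) S.2 = 0

theorem VanishesAt.frob {S : F[X] × F[X]} {Z : Points K A B} (h : VanishesAt S Z) :
    VanishesAt S (frob Z) := by
  unfold VanishesAt at *
  rw [xCoord_frob, yCoord_frob, aeval_pow_card, aeval_pow_card, ← mul_pow]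
  refine (map_add (FiniteField.frobeniusAlgHom F K) _ _).symm.trans ?_
  rw [h, map_zero]

theorem aeval_sigma {S : F[X] × F[X]} {Z : Points K A B} (hZ : Z ≠ 0) :
    aeval (xCoord Z) (sigma A B S) =
      (aeval (xCoord Z) S.1 + yCoord Z * aeval (xCoord Z) S.2) *
        (yCoord Z * aeval (xCoord Z) S.2 - aeval (xCoord Z) S.1) := by
  have h := yCoord_sq hZ
  simp only [sigma, cubic, map_sub, map_add, map_mul, map_pow, aeval_X, aeval_C]
  linear_combination -(aeval (xCoord Z) S.2) ^ 2 * h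

namespace Param

theorem vanishesAt_conj (H : Param p s pt) {S : F[X] × F[X]} {a b : ZMod p}
    (h : VanishesAt S (pt a)) (hab : Conj s a b) : VanishesAt S (pt b) := by
  obtain ⟨i, rfl⟩ := hab
  induction i with
  | zero => simpa using h
  | succ i ih =>
    rw [pow_succ', mul_assoc, ← H.map_frob]
    exact ih.frob

/-- The values at opposite points differ by `2y S₂(x)`, and `y ≠ 0`. -/
theorem dvd_of_vanishesAt_neg (H : Param p s pt) {S : F[X] × F[X]} {a : ZMod p} (ha : a ≠ 0)
    (h : VanishesAt S (pt a)) (h' : VanishesAt S (pt (-a))) :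
    minpoly F (xCoord (pt a)) ∣ S.1 ∧ minpoly F (xCoord (pt a)) ∣ S.2 := by
  unfold VanishesAt at *
  rw [map_neg, xCoord_neg, yCoord_neg] at h'
  have h2 : aeval (xCoord (pt a)) S.2 = 0 := by
    have : (2 * yCoord (pt a)) * aeval (xCoord (pt a)) S.2 = 0 := by linear_combination h - h'
    exact (mul_eq_zero.1 this).resolve_left (mul_ne_zero H.two_ne (H.y_ne ha))
  rw [h2, mul_zero, add_zero] at h
  exact ⟨minpoly.dvd F _ h, minpoly.dvd F _ h2⟩

theorem dvd_sigma_of_vanishesAt (H : Param p s pt) {S : F[X] × F[X]} {a : ZMod p} (ha : a ≠ 0)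
    (h : VanishesAt S (pt a)) : minpoly F (xCoord (pt a)) ∣ sigma A B S := by
  refine minpoly.dvd F _ ?_
  rw [aeval_sigma (H.pt_ne ha), show _ + _ = (0 : K) from h, zero_mul]

theorem dvd_line_iff_vanishesAt {S : F[X] × F[X]} {a : ZMod p} {L : Line F}
    (h : IsLineOf L (pt a)) : minpoly F (xCoord (pt a)) ∣ S.1 + (C L.a₁ * X + C L.a₀) * S.2 ↔
      VanishesAt S (pt a) := by
  rw [minpoly.dvd_iff, VanishesAt, h.mem.2]
  simp

end Param

end Param

/-! ### Base change and degrees of the explicit formulas. -/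

section Map

variable {F K : Type*} [Field F] [Field K] (f : F →+* K) (A B a a₀ b b₀ : F)

theorem map_sA4 : f (sA4 A B a a₀ b b₀) = sA4 (f A) (f B) (f a) (f a₀) (f b) (f b₀) := by
  simp only [sA4, map_add, map_sub, map_neg, map_mul, map_pow, map_ofNat]
theorem map_sA3 : f (sA3 A B a a₀ b b₀) = sA3 (f A) (f B) (f a) (f a₀) (f b) (f b₀) := by
  simp only [sA3, map_add, map_sub, map_mul, map_pow, map_ofNat]
theorem map_sA2 : f (sA2 A B a a₀ b b₀) = sA2 (f A) (f B) (f a) (f a₀) (f b) (f b₀) := by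
  simp only [sA2, map_add, map_sub, map_neg, map_mul, map_pow, map_ofNat]
theorem map_sA1 : f (sA1 A B a a₀ b b₀) = sA1 (f A) (f B) (f a) (f a₀) (f b) (f b₀) := by
  simp only [sA1, map_add, map_sub, map_neg, map_mul, map_pow, map_ofNat]
theorem map_sA0 : f (sA0 A B a a₀ b b₀) = sA0 (f A) (f B) (f a) (f a₀) (f b) (f b₀) := by
  simp only [sA0, map_add, map_sub, map_neg, map_mul, map_pow, map_ofNat]
theorem map_sB3 : f (sB3 A B a a₀ b b₀) = sB3 (f A) (f B) (f a) (f a₀) (f b) (f b₀) := by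
  simp only [sB3, map_add, map_sub, map_mul, map_pow, map_ofNat]
theorem map_sB2 : f (sB2 A B a a₀ b b₀) = sB2 (f A) (f B) (f a) (f a₀) (f b) (f b₀) := by
  simp only [sB2, map_add, map_sub, map_mul, map_pow, map_ofNat]
theorem map_sB1 : f (sB1 A B a a₀ b b₀) = sB1 (f A) (f B) (f a) (f a₀) (f b) (f b₀) := by
  simp only [sB1, map_add, map_sub, map_neg, map_mul, map_pow, map_ofNat]
theorem map_sB0 : f (sB0 A B a a₀ b b₀) = sB0 (f A) (f B) (f a) (f a₀) (f b) (f b₀) := by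
  simp only [sB0, map_add, map_sub, map_neg, map_mul, map_pow, map_ofNat]
theorem map_dblC : f (dblC A B a a₀) = dblC (f A) (f B) (f a) (f a₀) := by
  simp only [dblC, map_sub, map_mul, map_pow, map_ofNat]
theorem map_dblU1 : f (dblU1 A B a a₀) = dblU1 (f A) (f B) (f a) (f a₀) := by
  simp only [dblU1, map_add, map_sub, map_mul, map_pow, map_ofNat]
theorem map_dblU0 : f (dblU0 A B a a₀) = dblU0 (f A) (f B) (f a) (f a₀) := by
  simp only [dblU0, map_add, map_sub, map_neg, map_mul, map_pow, map_ofNat]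

end Map

section Shape

variable {F : Type*} [Field F] (A B : F) (L L' : Line F)

theorem sScale_ne_zero : sScale A B L L' ≠ 0 := by
  unfold sScale
  split_ifs with h
  · exact one_ne_zero
  · exact inv_ne_zero h

theorem natDegree_sPoly_fst_le : (sPoly A B L L').1.natDegree ≤ 4 := by
  refine (natDegree_C_mul_le _ _).trans ?_
  compute_degree

variable {A B L L'}

theorem sPoly_snd_monic (h : sB3 A B L.a₁ L.a₀ L'.a₁ L'.a₀ ≠ 0) :
    (sPoly A B L L').2.Monic ∧ (sPoly A B L L').2.natDegree = 3 := by
  have hs : sScale A B L L' = (sB3 A B L.a₁ L.a₀ L'.a₁ L'.a₀)⁻¹ := if_neg h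
  have h1 : (sPoly A B L L').2 = C 1 * X ^ 3 + C (sScale A B L L' * sB2 A B L.a₁ L.a₀ L'.a₁ L'.a₀) *
      X ^ 2 + C (sScale A B L L' * sB1 A B L.a₁ L.a₀ L'.a₁ L'.a₀) * X +
      C (sScale A B L L' * sB0 A B L.a₁ L.a₀ L'.a₁ L'.a₀) := by
    rw [← inv_mul_cancel₀ h, ← hs]
    simp only [sPoly, C_mul]
    ring
  rw [h1]
  exact ⟨by rw [Monic, leadingCoeff_cubic one_ne_zero], natDegree_cubic one_ne_zero⟩

/-- `S₁²` has degree at most 8, so `f S₂²` supplies the leading term. -/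
theorem sigma_monic {S : F[X] × F[X]} (h1 : S.1.natDegree ≤ 4) (h2 : S.2.Monic)
    (h3 : S.2.natDegree = 3) : (sigma A B S).Monic ∧ (sigma A B S).natDegree = 9 := by
  have hc : (cubic A B).Monic ∧ (cubic A B).natDegree = 3 := by
    have h : cubic A B = C 1 * X ^ 3 + C 0 * X ^ 2 + C A * X + C B := by simp [cubic]
    rw [h]
    exact ⟨by rw [Monic, leadingCoeff_cubic one_ne_zero], natDegree_cubic one_ne_zero⟩
  have hm := hc.1.mul (h2.pow 2)
  have hd : (cubic A B * S.2 ^ 2).natDegree = 9 := by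
    rw [hc.1.natDegree_mul (h2.pow 2), h2.natDegree_pow, hc.2, h3]
  have hlt : (S.1 ^ 2).natDegree < (cubic A B * S.2 ^ 2).natDegree := by
    rw [hd]
    exact (natDegree_pow_le_of_le 2 h1).trans_lt (by norm_num)
  refine ⟨hm.sub_of_left (degree_lt_degree hlt), ?_⟩
  rw [sigma, natDegree_sub_eq_left_of_natDegree_lt hlt, hd]

end Shape

/-! ### The explicit formulas at points of the trace zero subgroup. -/

section Param

variable {F : Type*} [Field F] [Fintype F] {K : Type*} [Field K] [DecidableEq K] [Algebra F K]
  {A B : F}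

theorem IsLineOf.vieta {L : Line F} {Z : Points K A B} (h : IsLineOf L Z) :
    xCoord Z + xCoord Z ^ Fintype.card F + xCoord Z ^ Fintype.card F ^ 2 =
        algebraMap F K L.a₁ ^ 2 ∧
      xCoord Z * xCoord Z ^ Fintype.card F + xCoord Z * xCoord Z ^ Fintype.card F ^ 2 +
          xCoord Z ^ Fintype.card F * xCoord Z ^ Fintype.card F ^ 2 =
        algebraMap F K A - 2 * algebraMap F K L.a₁ * algebraMap F K L.a₀ ∧
      xCoord Z * xCoord Z ^ Fintype.card F * xCoord Z ^ Fintype.card F ^ 2 =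
        algebraMap F K L.a₀ ^ 2 - algebraMap F K B := by
  have hm := h.map_eq
  generalize xCoord Z ^ Fintype.card F ^ 2 = z at *
  generalize xCoord Z ^ Fintype.card F = y at *
  generalize xCoord Z = x at *
  have h1 : (X - C x) * (X - C y) * (X - C z) =
      C 1 * X ^ 3 + C (-(x + y + z)) * X ^ 2 + C (x * y + x * z + y * z) * X + C (-(x * y * z)) := by
    simp only [C_1, C_neg, C_add, C_mul]
    ring
  have h2 : (cubic A B - (C L.a₁ * X + C L.a₀) ^ 2).map (algebraMap F K) =
      C 1 * X ^ 3 + C (-algebraMap F K L.a₁ ^ 2) * X ^ 2 +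
        C (algebraMap F K A - 2 * algebraMap F K L.a₁ * algebraMap F K L.a₀) * X +
        C (algebraMap F K B - algebraMap F K L.a₀ ^ 2) := by
    simp only [cubic, C_1, C_neg, C_sub, C_mul, C_pow, C_ofNat, Polynomial.map_sub,
      Polynomial.map_add, Polynomial.map_mul, Polynomial.map_pow, map_X, map_C]
    ring
  rw [h1, h2] at hm
  have e : (⟨1, -algebraMap F K L.a₁ ^ 2,
      algebraMap F K A - 2 * algebraMap F K L.a₁ * algebraMap F K L.a₀,
      algebraMap F K B - algebraMap F K L.a₀ ^ 2⟩ : Cubic K) =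
      ⟨1, -(x + y + z), x * y + x * z + y * z, -(x * y * z)⟩ := (Cubic.toPoly_injective _ _).1 hm
  obtain ⟨-, e2, e1, e0⟩ := Cubic.mk.inj e
  exact ⟨by linear_combination e2, by linear_combination -e1, by linear_combination e0⟩

variable {p : ℕ} {s : ZMod p} {pt : ZMod p →+ Points K A B}

namespace Param

theorem xCoord_s (H : Param p s pt) (a : ZMod p) :
    xCoord (pt (s * a)) = xCoord (pt a) ^ Fintype.card F := by
  rw [← H.map_frob, xCoord_frob]

theorem xCoord_s_sq (H : Param p s pt) (a : ZMod p) :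
    xCoord (pt (s ^ 2 * a)) = xCoord (pt a) ^ Fintype.card F ^ 2 := by
  rw [sq, mul_assoc, H.xCoord_s, H.xCoord_s, ← pow_mul, ← sq]

/-- The secant construction needs only distinct abscissas; `a` and `b` may still be conjugate up to
sign. -/
theorem vanishesAt_sPoly (H : Param p s pt) {a b : ZMod p} {L L' : Line F}
    (h : IsLineOf L (pt a)) (h' : IsLineOf L' (pt b)) (hne : a ≠ b) (hne' : a ≠ -b) :
    VanishesAt (sPoly A B L L') (pt (a + b)) := by
  have hx : xCoord (pt a) ≠ xCoord (pt b) := by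
    rw [Ne, xCoord_eq_iff h.mem.1 h'.mem.1, ← map_neg, H.inj.eq_iff, H.inj.eq_iff]
    tauto
  obtain ⟨l, n, e1, e2, h3, hA, hB, hy⟩ := exists_secant h.mem.1 h'.mem.1 hx
  rw [← map_add] at h3 hA hB hy
  have key := s_eval_secant _ _ l n h3 hA hB (h.mem.2.symm.trans e1) (h'.mem.2.symm.trans e2)
  rw [VanishesAt, hy]
  clear hy hA hB h3
  generalize xCoord (pt (a + b)) = x at *
  simp only [sPoly, map_add, map_mul, map_pow, aeval_C, aeval_X, map_sA4, map_sA3, map_sA2,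
    map_sA1, map_sA0, map_sB3, map_sB2, map_sB1, map_sB0]
  linear_combination algebraMap F K (sScale A B L L') * key

theorem sB3_ne_zero (H : Param p s pt) {a b : ZMod p} {L L' : Line F}
    (h : IsLineOf L (pt a)) (h' : IsLineOf L' (pt b)) (hab : ¬ Conj s a (-b)) :
    sB3 A B L.a₁ L.a₀ L'.a₁ L'.a₀ ≠ 0 := by
  -- A vanishing factor would put `-c` on the line of `b`, making `a` conjugate to `-b`.
  have key : ∀ c, Conj s a c → (algebraMap F K L.a₁ + algebraMap F K L'.a₁) * xCoord (pt c) +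
      (algebraMap F K L.a₀ + algebraMap F K L'.a₀) ≠ 0 := by
    intro c hc h0
    have hLc := H.frob_iter_line h hc
    have h1 : IsLineOf L' (pt (-c)) := by
      rw [map_neg]
      refine isLineOf_of_mem H.finrank (neg_ne_zero.2 hLc.mem.1) ?_ ?_
      · rw [xCoord_neg]
        exact H.moving (H.ne_zero_of_line hLc)
      · rw [xCoord_neg, yCoord_neg, hLc.mem.2]
        linear_combination -h0
    refine hab (hc.trans (H.conj_symm ?_))
    simpa using (H.conj_of_line h' h1).neg
  obtain ⟨v1, v2, v3⟩ := h.vieta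
  rw [← (algebraMap F K).injective.ne_iff, map_zero, map_sB3, sB3_eq_prod v1 v2 v3]
  refine mul_ne_zero (mul_ne_zero (key _ ⟨0, by simp⟩) ?_) ?_
  · rw [← H.xCoord_s]
    exact key _ ⟨1, by simp⟩
  · rw [← H.xCoord_s_sq]
    exact key _ ⟨2, rfl⟩

theorem isLineOf_dbl (H : Param p s pt) {a : ZMod p} {L : Line F} (h : IsLineOf L (pt a)) :
    ∃ L' : Line F, dbl A B L = some L' ∧ IsLineOf L' (pt (2 * a)) := by
  have : Fact p.Prime := ⟨H.prime⟩
  have key : ∀ c, Conj s a c →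
      algebraMap F K L.a₁ * xCoord (pt c) + algebraMap F K L.a₀ ≠ 0 := by
    intro c hc
    have hLc := H.frob_iter_line h hc
    rw [← hLc.mem.2]
    exact H.y_ne (H.ne_zero_of_line hLc)
  have ha := H.ne_zero_of_line h
  have hc : dblC A B L.a₁ L.a₀ ≠ 0 := by
    obtain ⟨v1, v2, v3⟩ := h.vieta
    rw [← (algebraMap F K).injective.ne_iff, map_zero, map_dblC, dblC_eq_prod v1 v2 v3]
    refine mul_ne_zero ?_ (mul_ne_zero (mul_ne_zero (key _ ⟨0, by simp⟩) ?_) ?_)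
    · have := pow_ne_zero 3 H.two_ne
      intro h
      exact this (by linear_combination -h)
    · rw [← H.xCoord_s]
      exact key _ ⟨1, by simp⟩
    · rw [← H.xCoord_s_sq]
      exact key _ ⟨2, rfl⟩
  refine ⟨_, if_neg hc, isLineOf_of_mem H.finrank (H.pt_ne ?_) (H.moving ?_) ?_⟩
  · exact mul_ne_zero H.two_ne' ha
  · exact mul_ne_zero H.two_ne' ha
  · obtain ⟨l, n, e1, -, h3, hA, hB, hy⟩ := exists_tangent H.two_ne h.mem.1 (H.y_ne ha)
    rw [← map_add, ← two_mul] at h3 hA hB hy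
    have e := dbl_eval_tangent (xCoord (pt a)) l n (l - algebraMap F K L.a₁)
      (a := algebraMap F K L.a₁) (a₀ := algebraMap F K L.a₀) h3 hA hB (by ring)
      (by linear_combination e1 - h.mem.2)
    rw [← hy] at e
    have hc' : algebraMap F K (dblC A B L.a₁ L.a₀) ≠ 0 := (_root_.map_ne_zero _).2 hc
    rw [map_div₀, map_div₀]
    refine mul_left_cancel₀ hc' ?_
    rw [mul_add, ← mul_assoc, mul_div_cancel₀ _ hc', mul_div_cancel₀ _ hc', map_dblC, map_dblU1,
      map_dblU0, e]

theorem s_sub_one_ne (H : Param p s pt) : s - 1 ≠ 0 := by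
  intro h
  have h1 : s = 1 := by linear_combination h
  have := H.rel
  rw [h1] at this
  exact H.three_ne (by linear_combination this)

/-- Modulo `s² + s + 1`, each of the six coincidences, after removing powers of `s` and a factor `s
- 1`, says that `a = 0`, that `b = 0`, or that `a` and `b` are conjugate. -/
theorem not_conj_add (H : Param p s pt) {a b : ZMod p} (ha : a ≠ 0) (hb : b ≠ 0)
    (hab : ¬ Conj s a b) : ¬ Conj s (a + b) (a + s * b) ∧ ¬ Conj s (a + b) (a + s ^ 2 * b) := by
  have hs := H.rel
  have h1 := H.s_sub_one_ne
  have hp : Fact p.Prime := ⟨H.prime⟩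
  rw [H.conj_iff, H.conj_iff]
  constructor
  · rintro (h | h | h)
    · exact mul_ne_zero h1 hb (by linear_combination h)
    · exact mul_ne_zero h1 ha (by linear_combination -h)
    · refine hab ⟨1, ?_⟩
      refine mul_left_cancel₀ (mul_ne_zero h1 H.s_ne) ?_
      linear_combination -h - a * (s - 1) * hs
  · rintro (h | h | h)
    · exact mul_ne_zero (mul_ne_zero h1 (H.pow_s_ne 2)) hb
        (by linear_combination -h + (s - 1) * b * hs)
    · refine hab (H.conj_symm ⟨1, ?_⟩)
      refine mul_left_cancel₀ h1 ?_
      linear_combination -h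
    · exact mul_ne_zero (mul_ne_zero h1 (H.pow_s_ne 2)) ha
        (by linear_combination h + (s - 1) * a * hs)

end Param

end Param

/-! ### The linear system as a divisibility condition. -/

section System

variable {F : Type*} [Field F]

theorem eq_quartic {g : F[X]} (h : g.natDegree ≤ 4) : g = C (g.coeff 4) * X ^ 4 +
    C (g.coeff 3) * X ^ 3 + C (g.coeff 2) * X ^ 2 + C (g.coeff 1) * X + C (g.coeff 0) := by
  conv_lhs => rw [g.as_sum_range' 5 (by omega)]
  simp only [Finset.sum_range_succ, Finset.sum_range_zero, ← C_mul_X_pow_eq_monomial, pow_zero,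
    pow_one, mul_one, zero_add]
  ring

theorem quartic_inj {a b c d e a' b' c' d' e' : F}
    (h : C a * X ^ 4 + C b * X ^ 3 + C c * X ^ 2 + C d * X + C e =
      C a' * X ^ 4 + C b' * X ^ 3 + C c' * X ^ 2 + C d' * X + C e') :
    a = a' ∧ b = b' ∧ c = c' ∧ d = d' ∧ e = e' := by
  have h4 := congrArg (fun g => coeff g 4) h
  have h3 := congrArg (fun g => coeff g 3) h
  have h2 := congrArg (fun g => coeff g 2) h
  have h1 := congrArg (fun g => coeff g 1) h
  have h0 := congrArg (fun g => coeff g 0) h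
  simp [coeff_X, coeff_C] at h4 h3 h2 h1 h0
  exact ⟨h4, h3, h2, h1, h0⟩

theorem coeff_of_monic_cubic {g : F[X]} (h : g.Monic) (hd : g.natDegree = 3) :
    g.coeff 4 = 0 ∧ g.coeff 3 = 1 :=
  ⟨coeff_eq_zero_of_natDegree_lt (by omega), by rw [← hd]; exact h⟩

/-- For degree reasons the quotient is linear. Its two coefficients are read off from `x⁴` and from
the constant term, the latter needing `w₀ ≠ 0`. The rows of the system are the comparisons at `x³`,
`x²`, `x`, multiplied by `w₀`. -/
theorem solvesSystem_iff {W : F[X]} {S : F[X] × F[X]} (hW : W.Monic) (hWd : W.natDegree = 3)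
    (hW0 : W.coeff 0 ≠ 0) (h1 : S.1.natDegree ≤ 4) (h2 : S.2.Monic) (h2d : S.2.natDegree = 3)
    (L : Line F) : SolvesSystem W S L ↔ W ∣ S.1 + (C L.a₁ * X + C L.a₀) * S.2 := by
  have eW := eq_quartic (g := W) (by omega)
  have e1 := eq_quartic h1
  have e2 := eq_quartic (g := S.2) (by omega)
  rw [(coeff_of_monic_cubic hW hWd).1, (coeff_of_monic_cubic hW hWd).2] at eW
  rw [(coeff_of_monic_cubic h2 h2d).1, (coeff_of_monic_cubic h2 h2d).2] at e2
  have eG : S.1 + (C L.a₁ * X + C L.a₀) * S.2 = C (S.1.coeff 4 + L.a₁) * X ^ 4 +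
      C (S.1.coeff 3 + L.a₁ * S.2.coeff 2 + L.a₀) * X ^ 3 +
      C (S.1.coeff 2 + L.a₁ * S.2.coeff 1 + L.a₀ * S.2.coeff 2) * X ^ 2 +
      C (S.1.coeff 1 + L.a₁ * S.2.coeff 0 + L.a₀ * S.2.coeff 1) * X +
      C (S.1.coeff 0 + L.a₀ * S.2.coeff 0) := by
    conv_lhs => rw [e1, e2]
    simp only [C_add, C_mul, C_0, C_1]
    ring
  have eWQ : ∀ u v : F, W * (C u * X + C v) = C u * X ^ 4 + C (u * W.coeff 2 + v) * X ^ 3 +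
      C (u * W.coeff 1 + v * W.coeff 2) * X ^ 2 + C (u * W.coeff 0 + v * W.coeff 1) * X +
      C (v * W.coeff 0) := by
    intro u v
    conv_lhs => rw [eW]
    simp only [C_add, C_mul, C_0, C_1]
    ring
  constructor
  · rintro ⟨s3, s2, s1⟩
    have hv : (S.1.coeff 0 + L.a₀ * S.2.coeff 0) / W.coeff 0 * W.coeff 0 =
      S.1.coeff 0 + L.a₀ * S.2.coeff 0 := div_mul_cancel₀ _ hW0
    refine ⟨C (S.1.coeff 4 + L.a₁) * X + C ((S.1.coeff 0 + L.a₀ * S.2.coeff 0) / W.coeff 0), ?_⟩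
    generalize (S.1.coeff 0 + L.a₀ * S.2.coeff 0) / W.coeff 0 = v at hv
    have f3 : S.1.coeff 3 + L.a₁ * S.2.coeff 2 + L.a₀ =
        (S.1.coeff 4 + L.a₁) * W.coeff 2 + v :=
      mul_right_cancel₀ hW0 (by linear_combination -s3 - hv)
    have f2 : S.1.coeff 2 + L.a₁ * S.2.coeff 1 + L.a₀ * S.2.coeff 2 =
        (S.1.coeff 4 + L.a₁) * W.coeff 1 + v * W.coeff 2 :=
      mul_right_cancel₀ hW0 (by linear_combination -s2 - W.coeff 2 * hv)
    have f1 : S.1.coeff 1 + L.a₁ * S.2.coeff 0 + L.a₀ * S.2.coeff 1 =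
        (S.1.coeff 4 + L.a₁) * W.coeff 0 + v * W.coeff 1 :=
      mul_right_cancel₀ hW0 (by linear_combination -s1 - W.coeff 1 * hv)
    rw [eG, eWQ, hv, f3, f2, f1]
  · rintro ⟨Q, hQ⟩
    have hQd : Q.natDegree ≤ 1 := by
      by_cases h0 : Q = 0
      · simp [h0]
      · have hG : (S.1 + (C L.a₁ * X + C L.a₀) * S.2).natDegree ≤ 4 := by
          rw [eG]
          compute_degree
        rw [hQ, hW.natDegree_mul' h0] at hG
        omega
    rw [eG, eq_X_add_C_of_natDegree_le_one hQd, eWQ] at hQ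
    obtain ⟨q4, q3, q2, q1, q0⟩ := quartic_inj hQ
    refine ⟨?_, ?_, ?_⟩
    · linear_combination -W.coeff 0 * q3 + W.coeff 2 * W.coeff 0 * q4 + q0
    · linear_combination -W.coeff 0 * q2 + W.coeff 1 * W.coeff 0 * q4 + W.coeff 2 * q0
    · linear_combination -W.coeff 0 * q1 + W.coeff 0 ^ 2 * q4 + W.coeff 1 * q0

/-- The difference of two solutions is a linear `g` with `W ∣ g S₂`. As `W` is prime of degree
three, either `g = 0` or `W = S₂`. -/
theorem solveSystem_eq_some {W : F[X]} {S : F[X] × F[X]} (hi : Irreducible W) (hW : W.Monic)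
    (hWd : W.natDegree = 3) (h1 : S.1.natDegree ≤ 4) (h2 : S.2.Monic) (h2d : S.2.natDegree = 3)
    (hne : W ≠ S.2) {L : Line F} (hL : W ∣ S.1 + (C L.a₁ * X + C L.a₀) * S.2) :
    solveSystem W S = some L := by
  have hW0 : W.coeff 0 ≠ 0 := by
    intro h
    have hx : X ∣ W := X_dvd_iff.2 h
    have := natDegree_eq_of_degree_eq (degree_eq_degree_of_associated
      (irreducible_X.associated_of_dvd hi hx))
    rw [natDegree_X, hWd] at this
    omega
  have hu : ∀ L', SolvesSystem W S L' → L' = L := by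
    intro L' h'
    rw [solvesSystem_iff hW hWd hW0 h1 h2 h2d] at h'
    have hd := dvd_sub h' hL
    have e : S.1 + (C L'.a₁ * X + C L'.a₀) * S.2 - (S.1 + (C L.a₁ * X + C L.a₀) * S.2) =
        (C (L'.a₁ - L.a₁) * X + C (L'.a₀ - L.a₀)) * S.2 := by
      simp only [C_sub]
      ring
    rw [e] at hd
    rcases hi.prime.dvd_or_dvd hd with hd | hd
    · have h0 := eq_zero_of_dvd_of_natDegree_lt hd
        (natDegree_linear_le.trans_lt (by rw [hWd]; norm_num))
      have c1 := congrArg (fun g => coeff g 1) h0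
      have c0 := congrArg (fun g => coeff g 0) h0
      simp [coeff_X, coeff_C] at c1 c0
      exact Line.ext (sub_eq_zero.1 c1) (sub_eq_zero.1 c0)
    · exact absurd (eq_of_monic_of_dvd_of_natDegree_le hW h2 hd (by omega)).symm hne
  have hex : ∃! L', SolvesSystem W S L' :=
    ⟨L, (solvesSystem_iff hW hWd hW0 h1 h2 h2d L).2 hL, hu⟩
  rw [solveSystem, dif_pos hex, hu _ hex.choose_spec.1]

end System

theorem Irreducible.eq_of_monic_of_dvd {F : Type*} [Field F] {g h : F[X]} (hg : Irreducible g)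
    (hh : Irreducible h) (mg : g.Monic) (mh : h.Monic) (hd : g ∣ h) : g = h :=
  eq_of_monic_of_associated mg mh (hg.associated_of_dvd hh hd)

/-! ### Factorization of the norm `f S₂² - S₁²`. -/

section Param

variable {F : Type*} [Field F] [Fintype F] {K : Type*} [Field K] [DecidableEq K] [Algebra F K]
  {A B : F} {p : ℕ} {s : ZMod p} {pt : ZMod p →+ Points K A B}

/-- The minimal polynomial of the abscissa of `pt a`. -/
noncomputable abbrev minX (pt : ZMod p →+ Points K A B) (a : ZMod p) : F[X] := minpoly F (xCoord (pt a))

namespace Param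

theorem minX_eq_of_dvd (H : Param p s pt) {a b : ZMod p} (h : minX pt a ∣ minX pt b) :
    minX pt a = minX pt b :=
  Irreducible.eq_of_monic_of_dvd (H.irreducible_minpoly a) (H.irreducible_minpoly b)
    (H.monic_minpoly a) (H.monic_minpoly b) h

theorem isCoprime_minX (H : Param p s pt) {a b : ZMod p} (h : minX pt a ≠ minX pt b) :
    IsCoprime (minX pt a) (minX pt b) :=
  (H.irreducible_minpoly a).coprime_iff_not_dvd.2 fun hd => h (H.minX_eq_of_dvd hd)

/-- Opposite zeros put the minimal polynomial into both `S₁` and `S₂`. This supplies the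
multiplicity when two orbits of zeros share their abscissas. -/
theorem sq_dvd_sigma (H : Param p s pt) {S : F[X] × F[X]} {a : ZMod p} (ha : a ≠ 0)
    (h : VanishesAt S (pt a)) (h' : VanishesAt S (pt (-a))) :
    minX pt a * minX pt a ∣ sigma A B S := by
  obtain ⟨⟨u, hu⟩, ⟨v, hv⟩⟩ := H.dvd_of_vanishesAt_neg ha h h'
  exact ⟨cubic A B * v ^ 2 - u ^ 2, by rw [sigma, hu, hv]; ring⟩

theorem mul_dvd_sigma (H : Param p s pt) {S : F[X] × F[X]} {u v : ZMod p} (hu : u ≠ 0)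
    (hv : v ≠ 0) (Vu : VanishesAt S (pt u)) (Vv : VanishesAt S (pt v)) (huv : ¬ Conj s u v) :
    minX pt u * minX pt v ∣ sigma A B S := by
  by_cases e : minX pt u = minX pt v
  · have hc := (H.conj_of_minpoly hu hv e).resolve_left huv
    rw [e]
    exact H.sq_dvd_sigma hv Vv (H.vanishesAt_conj Vu hc)
  · exact (H.isCoprime_minX e).mul_dvd (H.dvd_sigma_of_vanishesAt hu Vu)
      (H.dvd_sigma_of_vanishesAt hv Vv)

/-- At most two orbits, opposite to each other, share a minimal polynomial. -/
theorem minX_ne_of_eq (H : Param p s pt) {u v w : ZMod p} (hu : u ≠ 0) (hv : v ≠ 0) (hw : w ≠ 0)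
    (huv : ¬ Conj s u v) (huw : ¬ Conj s u w) (hvw : ¬ Conj s v w)
    (e : minX pt u = minX pt v) : minX pt u ≠ minX pt w := by
  intro e'
  have h1 := (H.conj_of_minpoly hu hv e).resolve_left huv
  have h2 := (H.conj_of_minpoly hu hw e').resolve_left huw
  exact hvw (by simpa using ((H.conj_symm h1).trans h2).neg)

/-- Distinct factors are coprime, and a repeated one comes from opposite zeros and divides twice; so
the product divides the norm, and both are monic of degree 9. -/
theorem sigma_eq_mul (H : Param p s pt) {S : F[X] × F[X]} (h1 : S.1.natDegree ≤ 4)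
    (h2 : S.2.Monic) (h3 : S.2.natDegree = 3) {u v w : ZMod p} (hu : u ≠ 0) (hv : v ≠ 0)
    (hw : w ≠ 0) (Vu : VanishesAt S (pt u)) (Vv : VanishesAt S (pt v))
    (Vw : VanishesAt S (pt w)) (huv : ¬ Conj s u v) (huw : ¬ Conj s u w) (hvw : ¬ Conj s v w) :
    sigma A B S = minX pt u * minX pt v * minX pt w := by
  have hd : minX pt u * minX pt v * minX pt w ∣ sigma A B S := by
    by_cases e : minX pt u = minX pt w
    · have e' := H.minX_ne_of_eq hu hw hv huw huv (fun h => hvw (H.conj_symm h)) e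
      rw [mul_right_comm]
      exact ((H.isCoprime_minX e').mul_left (H.isCoprime_minX (e ▸ e'))).mul_dvd
        (H.mul_dvd_sigma hu hw Vu Vw huw) (H.dvd_sigma_of_vanishesAt hv Vv)
    · by_cases e1 : minX pt v = minX pt w
      · rw [mul_assoc]
        refine IsCoprime.mul_dvd (IsCoprime.mul_right ?_ (H.isCoprime_minX e))
          (H.dvd_sigma_of_vanishesAt hu Vu) (H.mul_dvd_sigma hv hw Vv Vw hvw)
        exact H.isCoprime_minX (e1 ▸ e)
      · exact ((H.isCoprime_minX e).mul_left (H.isCoprime_minX e1)).mul_dvd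
          (H.mul_dvd_sigma hu hv Vu Vv huv) (H.dvd_sigma_of_vanishesAt hw Vw)
  obtain ⟨hm, hdeg⟩ := sigma_monic (A := A) (B := B) h1 h2 h3
  have huv' := (H.monic_minpoly u).mul (H.monic_minpoly v)
  refine eq_of_monic_of_dvd_of_natDegree_le (huv'.mul (H.monic_minpoly w)) hm hd ?_
  rw [hdeg, huv'.natDegree_mul (H.monic_minpoly w), (H.monic_minpoly u).natDegree_mul
    (H.monic_minpoly v), H.natDegree_minpoly hu, H.natDegree_minpoly hv, H.natDegree_minpoly hw]

/-- If `c` is conjugate to `-u`, the factor of `u` occurs twice in the norm. Hence `v` or `w` shares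
it, and must then be conjugate to `-u`, that is, to `c`. -/
theorem conj_of_minX_eq_of_sigma (H : Param p s pt) {S : F[X] × F[X]} {u v w c : ZMod p}
    (hu : u ≠ 0) (hv : v ≠ 0) (hw : w ≠ 0) (hc : c ≠ 0) (Vu : VanishesAt S (pt u))
    (Vc : VanishesAt S (pt c)) (huv : ¬ Conj s u v) (huw : ¬ Conj s u w)
    (hs : sigma A B S = minX pt u * minX pt v * minX pt w) (e : minX pt c = minX pt u) :
    Conj s u c ∨ Conj s v c ∨ Conj s w c := by
  rcases H.conj_of_minpoly hu hc e.symm with h | h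
  · exact .inl h
  have hn : Conj s c (-u) := by simpa using (H.conj_symm h).neg
  have hd := H.sq_dvd_sigma hu Vu (H.vanishesAt_conj Vc hn)
  rw [hs, mul_assoc, mul_dvd_mul_iff_left (H.irreducible_minpoly u).ne_zero] at hd
  rcases (H.irreducible_minpoly u).prime.dvd_or_dvd hd with hd | hd
  · have := (H.conj_of_minpoly hu hv (H.minX_eq_of_dvd hd)).resolve_left huv
    exact .inr (.inl (by simpa using ((H.conj_symm this).trans h).neg))
  · have := (H.conj_of_minpoly hu hw (H.minX_eq_of_dvd hd)).resolve_left huw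
    exact .inr (.inr (by simpa using ((H.conj_symm this).trans h).neg))

end Param

/-- `S = S₁ + y S₂` has `S₂` a monic cubic, `deg S₁ ≤ 4`, and all cubic factors of `f S₂² - S₁²`
come from zeros of `S` in the trace zero subgroup. -/
structure GoodPair (pt : ZMod p →+ Points K A B) (S : F[X] × F[X]) : Prop where
  natDegree_le : S.1.natDegree ≤ 4
  monic : S.2.Monic
  natDegree_eq : S.2.natDegree = 3
  exists_zero : ∀ W : F[X], Irreducible W → W.Monic → W ∣ sigma A B S →
    ∃ z, z ≠ 0 ∧ VanishesAt S (pt z) ∧ W = minX pt z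

namespace Param

theorem conj_of_conj_pow_mul (H : Param p s pt) {a b : ZMod p} (i : ℕ)
    (h : Conj s a (s ^ i * b)) : Conj s a b :=
  h.trans (H.conj_symm ⟨i, rfl⟩)

/-- The two exclusions make the three sums nonzero and pairwise non-conjugate, and `b₃ ≠ 0`; the
three orbits then exhaust the norm. -/
theorem sPoly_spec (H : Param p s pt) {a b : ZMod p} {L L' : Line F}
    (h : IsLineOf L (pt a)) (h' : IsLineOf L' (pt b)) (hab : ¬ Conj s a b)
    (hab' : ¬ Conj s a (-b)) : GoodPair pt (sPoly A B L L') ∧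
      ∀ c, c ≠ 0 → VanishesAt (sPoly A B L L') (pt c) →
        Conj s (a + b) c ∨ Conj s (a + s * b) c ∨ Conj s (a + s ^ 2 * b) c := by
  have : Fact p.Prime := ⟨H.prime⟩
  have ha := H.ne_zero_of_line h
  have hb := H.ne_zero_of_line h'
  have hz : ∀ i : ℕ, a + s ^ i * b ≠ 0 ∧ VanishesAt (sPoly A B L L') (pt (a + s ^ i * b)) := by
    intro i
    have hi : Conj s b (s ^ i * b) := ⟨i, rfl⟩
    refine ⟨fun h0 => hab' ?_, H.vanishesAt_sPoly h (H.frob_iter_line h' hi) ?_ ?_⟩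
    · refine H.conj_of_conj_pow_mul i ⟨0, ?_⟩
      linear_combination -h0
    · exact fun e => hab (H.conj_of_conj_pow_mul i ⟨0, by rw [← e]; simp⟩)
    · exact fun e => hab' (H.conj_of_conj_pow_mul i ⟨0, by rw [e]; simp⟩)
  have h0 := hz 0
  have h1 := hz 1
  have h2 := hz 2
  rw [pow_zero, one_mul] at h0
  rw [pow_one] at h1
  obtain ⟨n01, n02⟩ := H.not_conj_add ha hb hab
  have n12 : ¬ Conj s (a + s * b) (a + s ^ 2 * b) := by
    have := (H.not_conj_add ha (mul_ne_zero H.s_ne hb)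
      fun h => hab (H.conj_of_conj_pow_mul 1 (by simpa using h))).1
    rwa [← mul_assoc, ← sq] at this
  have n10 := fun h => n01 (H.conj_symm h)
  have n20 := fun h => n02 (H.conj_symm h)
  have n21 := fun h => n12 (H.conj_symm h)
  obtain ⟨hm, hd⟩ := sPoly_snd_monic (H.sB3_ne_zero h h' hab')
  have hs := H.sigma_eq_mul (natDegree_sPoly_fst_le A B L L') hm hd h0.1 h1.1 h2.1 h0.2 h1.2 h2.2
    n01 n02 n12
  have fac : ∀ W : F[X], Irreducible W → W.Monic → W ∣ sigma A B (sPoly A B L L') →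
      W = minX pt (a + b) ∨ W = minX pt (a + s * b) ∨ W = minX pt (a + s ^ 2 * b) := by
    intro W hi hW hWd
    have key : ∀ c, W ∣ minX pt c → W = minX pt c := fun c =>
      Irreducible.eq_of_monic_of_dvd hi (H.irreducible_minpoly c) hW (H.monic_minpoly c)
    rw [hs] at hWd
    rcases hi.prime.dvd_or_dvd hWd with hWd | hWd
    · rcases hi.prime.dvd_or_dvd hWd with hWd | hWd
      · exact .inl (key _ hWd)
      · exact .inr (.inl (key _ hWd))
    · exact .inr (.inr (key _ hWd))
  refine ⟨⟨natDegree_sPoly_fst_le A B L L', hm, hd, ?_⟩, ?_⟩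
  · intro W hi hW hWd
    rcases fac W hi hW hWd with e | e | e
    · exact ⟨_, h0.1, h0.2, e⟩
    · exact ⟨_, h1.1, h1.2, e⟩
    · exact ⟨_, h2.1, h2.2, e⟩
  · intro c hc Vc
    rcases fac _ (H.irreducible_minpoly c) (H.monic_minpoly c)
      (H.dvd_sigma_of_vanishesAt hc Vc) with e | e | e
    · exact H.conj_of_minX_eq_of_sigma h0.1 h1.1 h2.1 hc h0.2 Vc n01 n02 hs e
    · have := H.conj_of_minX_eq_of_sigma h1.1 h0.1 h2.1 hc h1.2 Vc n10 n12 (hs.trans (by ring)) e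
      tauto
    · have := H.conj_of_minX_eq_of_sigma h2.1 h0.1 h1.1 hc h2.2 Vc n20 n21 (hs.trans (by ring)) e
      tauto

/-- If the second line is the negative of the first one, then `S` is a cubic in `x`. -/
theorem toMonic_sPoly_neg (H : Param p s pt) {a b : ZMod p} {L L' : Line F}
    (h : IsLineOf L (pt a)) (h' : IsLineOf L' (pt b)) (hL : L = L'.neg) (hne : a ≠ b)
    (hne' : a + b ≠ 0) : toMonic (sPoly A B L L').1 = minX pt (a + b) := by
  have hL' : L'.a₁ = -L.a₁ ∧ L'.a₀ = -L.a₀ := by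
    rw [hL]
    exact ⟨(neg_neg _).symm, (neg_neg _).symm⟩
  have hV := H.vanishesAt_sPoly h h' hne (fun e => hne' (by rw [e]; ring))
  have ha := H.ne_zero_of_line h
  have e1 : (sPoly A B L L').1 = C (sScale A B L L') *
      (C (sA3 A B L.a₁ L.a₀ L'.a₁ L'.a₀) * X ^ 3 + C (sA2 A B L.a₁ L.a₀ L'.a₁ L'.a₀) * X ^ 2 +
        C (sA1 A B L.a₁ L.a₀ L'.a₁ L'.a₀) * X + C (sA0 A B L.a₁ L.a₀ L'.a₁ L'.a₀)) := by
    simp only [sPoly, hL'.1, hL'.2, sA4_neg, C_0, zero_mul, zero_add]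
  have e2 : (sPoly A B L L').2 = 0 := by
    simp only [sPoly, hL'.1, hL'.2, sB3_neg, sB2_neg, sB1_neg, sB0_neg, C_0, zero_mul, add_zero,
      mul_zero]
  have h3 : sA3 A B L.a₁ L.a₀ L'.a₁ L'.a₀ ≠ 0 := by
    obtain ⟨v1, v2, v3⟩ := h.vieta
    have hx := H.moving ha
    have hx2 := pow_card_sq_ne H.finrank hx
    have hx12 : xCoord (pt a) ^ Fintype.card F ≠ xCoord (pt a) ^ Fintype.card F ^ 2 := by
      rw [sq, pow_mul]
      exact fun h => hx (pow_card_injective (F := F) h).symm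
    rw [hL'.1, hL'.2, ← (algebraMap F K).injective.ne_iff, map_zero, map_sA3, map_neg, map_neg,
      sA3_neg v1 v2 v3]
    exact neg_ne_zero.2 (pow_ne_zero _ (mul_ne_zero (mul_ne_zero (sub_ne_zero.2 hx.symm)
      (sub_ne_zero.2 hx2.symm)) (sub_ne_zero.2 hx12)))
  have hd : (sPoly A B L L').1.natDegree = 3 := by
    rw [e1, natDegree_C_mul (sScale_ne_zero A B L L'), natDegree_cubic h3]
  have h0 : (sPoly A B L L').1 ≠ 0 := by
    intro h
    rw [h, natDegree_zero] at hd
    omega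
  rw [VanishesAt, e2, map_zero, mul_zero, add_zero] at hV
  have hl : (sPoly A B L L').1.leadingCoeff⁻¹ ≠ 0 := inv_ne_zero (leadingCoeff_ne_zero.2 h0)
  -- `S` is now a cubic in `x` vanishing at an abscissa of degree three.
  refine eq_of_monic_of_dvd_of_natDegree_le (H.monic_minpoly _) ?_ ?_ ?_
  · exact monic_C_mul_of_mul_leadingCoeff_eq_one (inv_mul_cancel₀ (leadingCoeff_ne_zero.2 h0))
  · exact (minpoly.dvd F _ hV).mul_left _
  · rw [toMonic, natDegree_C_mul hl, hd, H.natDegree_minpoly hne']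

end Param

end Param

theorem of_mem_cubicFactors {F : Type*} [Field F] {G W : F[X]} (hG : G ≠ 0) (h : W ∈ cubicFactors G) :
    Irreducible W ∧ W.Monic ∧ W ∣ G := by
  classical
  rw [cubicFactors, Finset.mem_filter, Multiset.mem_toFinset,
    UniqueFactorizationMonoid.mem_normalizedFactors_iff' hG] at h
  obtain ⟨⟨hi, hn, hd⟩, -⟩ := h
  exact ⟨hi, hn ▸ monic_normalize hi.ne_zero, hd⟩

/-! ### Correctness of the subalgorithm. -/

section Param

variable {F : Type*} [Field F] [Fintype F] {K : Type*} [Field K] [DecidableEq K] [Algebra F K]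
  {A B : F} {p : ℕ} {s : ZMod p} {pt : ZMod p →+ Points K A B}

namespace Param

theorem solveSystem_minX (H : Param p s pt) {S : F[X] × F[X]} (gS : GoodPair pt S) {z : ZMod p}
    {L : Line F} (hL : IsLineOf L (pt z)) (V : VanishesAt S (pt z)) (hne : minX pt z ≠ S.2) :
    solveSystem (minX pt z) S = some L :=
  solveSystem_eq_some (H.irreducible_minpoly z) (H.monic_minpoly z)
    (H.natDegree_minpoly (H.ne_zero_of_line hL)) gS.natDegree_le gS.monic gS.natDegree_eq hne
    ((dvd_line_iff_vanishesAt hL).2 V)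

/-- Modulo `W = S₂` the function `S` reduces to `S₁` and no longer sees the sign of `y`. This is
when `L(W, S)` cannot tell `z` from `-z`. -/
theorem minX_eq_snd_iff (H : Param p s pt) {S : F[X] × F[X]} (gS : GoodPair pt S) {z : ZMod p}
    (hz : z ≠ 0) (V : VanishesAt S (pt z)) :
    minX pt z = S.2 ↔ VanishesAt S (pt (-z)) := by
  constructor
  · intro e
    have h0 : aeval (xCoord (pt z)) S.2 = 0 := by rw [← e]; exact minpoly.aeval F _
    unfold VanishesAt at *
    rw [map_neg, xCoord_neg, yCoord_neg, h0, mul_zero, add_zero]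
    rwa [h0, mul_zero, add_zero] at V
  · intro V'
    refine (eq_of_monic_of_dvd_of_natDegree_le (H.monic_minpoly z) gS.monic
      (H.dvd_of_vanishesAt_neg hz V V').2 ?_).symm
    rw [gS.natDegree_eq, H.natDegree_minpoly hz]

/-- Only the orbit of `t` consists of common zeros, so any `W` that ends the loop yields the line of
`t`, in whatever order the list runs, and the `W` of `t` is never rejected. -/
theorem factorLoop_eq_some (H : Param p s pt) (h2 : ringChar F ≠ 2) {S T : F[X] × F[X]}
    (gS : GoodPair pt S) (gT : GoodPair pt T) {t : ZMod p} {L : Line F} (hL : IsLineOf L (pt t))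
    (hC : ∀ z, z ≠ 0 → VanishesAt S (pt z) → VanishesAt T (pt z) → Conj s t z)
    (VS : VanishesAt S (pt t)) (VT : VanishesAt T (pt t)) (l : List F[X])
    (hl : ∀ W ∈ l, Irreducible W ∧ W.Monic ∧ W ∣ sigma A B S ∧ W ∣ sigma A B T)
    (ht : minX pt t ∈ l) : factorLoop S T l = some L := by
  have ht0 := H.ne_zero_of_line hL
  induction l with
  | nil => simp at ht
  | cons W l ih =>
    obtain ⟨Wi, Wm, WS, WT⟩ := hl W (by simp)
    obtain ⟨z, hz, Vz, rfl⟩ := gS.exists_zero W Wi Wm WS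
    rw [factorLoop]
    by_cases e : minX pt z = S.2
    -- Both `z` and `-z` are zeros of `S`, so the zero `z'` of `T` belonging to `W` is a common one,
    -- hence conjugate to `t`. Now `-t` is also a zero of `S`, so it is not one of `T`, and `L(W,
    -- T)` has a unique solution.
    · rw [if_neg (not_not.2 e)]
      obtain ⟨z', hz', Vz', e'⟩ := gT.exists_zero _ Wi Wm WT
      have Vn := (H.minX_eq_snd_iff gS hz Vz).1 e
      have hc : Conj s t z' := by
        refine hC z' hz' ?_ Vz'
        rcases H.conj_of_minpoly hz hz' e' with h | h
        · exact H.vanishesAt_conj Vz h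
        · exact H.vanishesAt_conj Vn (by simpa using h.neg)
      rw [e', minX, H.minpoly_conj hc]
      refine H.solveSystem_minX gT hL VT fun eT => H.not_conj_neg ht0 (hC _ (neg_ne_zero.2 ht0) ?_
        ((H.minX_eq_snd_iff gT ht0 VT).1 eT))
      exact (H.minX_eq_snd_iff gS ht0 VS).1 (by rw [← e, e', minX, minX, H.minpoly_conj hc])
    · rw [if_pos e]
      obtain ⟨L', hL'⟩ := H.exists_line hz
      rw [H.solveSystem_minX gS hL' Vz e]
      simp only
      rw [add_comm, dvd_line_iff_vanishesAt hL']
      split_ifs with h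
      · rw [H.line_unique h2 hL hL' (hC z hz Vz h)]
      -- A rejected `W` does not belong to `t`: a `z` conjugate to `t` passes the test, and one
      -- conjugate to `-t` gives opposite zeros of `S`, hence `W = S₂`.
      · refine ih (fun W hW => hl W (by simp [hW])) ((List.mem_cons.1 ht).resolve_left fun et => ?_)
        rcases H.conj_of_minpoly ht0 hz et with hc | hc
        · exact h (H.vanishesAt_conj VT hc)
        · refine e ((H.minX_eq_snd_iff gS hz Vz).2 (H.vanishesAt_conj VS hc))

theorem minX_mem_cubicFactors (H : Param p s pt) {t : ZMod p} (ht : t ≠ 0) {G : F[X]}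
    (hG : G ≠ 0) (h : minX pt t ∣ G) : minX pt t ∈ cubicFactors G := by
  classical
  rw [cubicFactors, Finset.mem_filter, Multiset.mem_toFinset,
    UniqueFactorizationMonoid.mem_normalizedFactors_iff' hG]
  exact ⟨⟨H.irreducible_minpoly t, (H.monic_minpoly t).normalize_eq_self, h⟩,
    H.natDegree_minpoly ht⟩

theorem subalg_eq_some (H : Param p s pt) (h2 : ringChar F ≠ 2)
    {enum : Finset F[X] → List F[X]} (henum : ∀ Z : Finset F[X], (enum Z : Multiset F[X]) = Z.val)
    {a b c d : ZMod p} {M₁ M₂ N₁ N₂ : Line F} (ha : IsLineOf M₁ (pt a)) (hb : IsLineOf M₂ (pt b))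
    (hc : IsLineOf N₁ (pt c)) (hd : IsLineOf N₂ (pt d)) (hsum : a + b = c + d) (h0 : a + b ≠ 0)
    (hab : a ≠ b) (hcd : c ≠ d)
    (hC : ∀ z, (Conj s (a + b) z ∨ Conj s (a + s * b) z ∨ Conj s (a + s ^ 2 * b) z) →
      (Conj s (c + d) z ∨ Conj s (c + s * d) z ∨ Conj s (c + s ^ 2 * d) z) →
      Conj s (a + b) z) :
    ∃ L : Line F, subalg enum A B M₁ M₂ N₁ N₂ = some L ∧ IsLineOf L (pt (a + b)) := by
  -- Equal lines with `x ≠ y` mean `y = sx` or `y = s²x`; then `x + y` is `-s²x` or `-sx`, whose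
  -- line is the negated one.
  have hfix : ∀ {x y : ZMod p} {L L' : Line F}, IsLineOf L (pt x) → IsLineOf L' (pt y) → x ≠ y →
      L = L' → Conj s (x + y) (-x) := by
    intro x y L L' hx hy hxy e
    have := H.conj_of_line hx (e ▸ hy)
    rw [H.conj_iff] at this ⊢
    have hr := H.rel
    have h3 := H.cube
    rcases this with e | e | e
    · exact absurd e.symm hxy
    · subst e
      right; left
      linear_combination (-x) * hr
    · subst e
      right; right
      linear_combination (-x) * hr - s * x * h3
  -- If `y` is conjugate but not equal to `-x`, then `-(x + y)` is conjugate to another of the three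
  -- sums. Both signs occur, so this pair alone cannot fix the sign of the answer.
  have hfixneg : ∀ {x y : ZMod p} {L L' : Line F}, IsLineOf L (pt x) → IsLineOf L' (pt y) →
      x + y ≠ 0 → Conj s x (-y) →
      Conj s (x + s * y) (-(x + y)) ∨ Conj s (x + s ^ 2 * y) (-(x + y)) := by
    intro x y L L' hx hy hxy e
    have hr := H.rel
    have h3 := H.cube
    rw [H.conj_iff] at e
    rw [H.conj_iff, H.conj_iff]
    rcases e with e | e | e
    · exact absurd (by linear_combination -e) hxy
    · obtain rfl : y = -(s * x) := by linear_combination -e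
      left; right; left
      linear_combination x * h3
    · obtain rfl : y = -(s ^ 2 * x) := by linear_combination -e
      right; right; right
      linear_combination (x + s ^ 3 * x) * h3
  have hset : ∀ {x y z : ZMod p}, Conj s (x + s * y) z ∨ Conj s (x + s ^ 2 * y) z →
      Conj s (x + y) z ∨ Conj s (x + s * y) z ∨ Conj s (x + s ^ 2 * y) z := Or.inr
  have h0' : c + d ≠ 0 := hsum ▸ h0
  have hnt := H.not_conj_neg h0
  have hn0 := neg_ne_zero.2 h0
  obtain ⟨L, hL⟩ := H.exists_line h0
  have hL' := hL
  rw [hsum] at hL'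
  rw [subalg]
  split_ifs with e1 e2 e3 e4
  · exact ⟨_, rfl, H.frob_iter_line (H.line_neg ha) (H.conj_symm (hfix ha hb hab e1))⟩
  · refine ⟨_, rfl, H.frob_iter_line (H.line_neg hc) ?_⟩
    rw [hsum]
    exact H.conj_symm (hfix hc hd hcd e2)
  all_goals
    have hnab : ¬ Conj s a b := fun h => e1 (H.line_unique h2 ha hb h)
    have hncd : ¬ Conj s c d := fun h => e2 (H.line_unique h2 hc hd h)
  · have hnegS := hset (hfixneg ha hb h0 (H.conj_of_line ha (e3 ▸ H.line_neg hb)))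
    -- Were the second pair degenerate too, `-t` would lie in both triples, against `hC`.
    have hncd' : ¬ Conj s c (-d) := fun h =>
      hnt (hC _ hnegS (hsum ▸ hset (hfixneg hc hd h0' h)))
    obtain ⟨gT, hT⟩ := H.sPoly_spec hc hd hncd hncd'
    have VT := H.vanishesAt_sPoly hc hd hcd fun e => h0' (by rw [e]; ring)
    refine ⟨L, ?_, hL⟩
    change solveSystem (toMonic (sPoly A B M₁ M₂).1) _ = _
    rw [H.toMonic_sPoly_neg ha hb e3 hab h0, hsum]
    refine H.solveSystem_minX gT hL' VT fun e => hnt (hC _ hnegS ?_)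
    refine hT _ hn0 ?_
    rw [hsum]
    exact (H.minX_eq_snd_iff gT h0' VT).1 e
  · have hnegT := hset (hfixneg hc hd h0' (H.conj_of_line hc (e4 ▸ H.line_neg hd)))
    rw [← hsum] at hnegT
    have hnab' : ¬ Conj s a (-b) := fun h => e3 (H.line_unique h2 ha (H.line_neg hb) h)
    obtain ⟨gS, hS⟩ := H.sPoly_spec ha hb hnab hnab'
    have VS := H.vanishesAt_sPoly ha hb hab fun e => h0 (by rw [e]; ring)
    refine ⟨L, ?_, hL⟩
    change solveSystem (toMonic (sPoly A B N₁ N₂).1) _ = _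
    rw [H.toMonic_sPoly_neg hc hd e4 hcd h0', ← hsum]
    refine H.solveSystem_minX gS hL VS fun e => hnt (hC _ (hS _ hn0 ?_) (by rwa [hsum] at hnegT ⊢))
    exact (H.minX_eq_snd_iff gS h0 VS).1 e
  · have hnab' : ¬ Conj s a (-b) := fun h => e3 (H.line_unique h2 ha (H.line_neg hb) h)
    have hncd' : ¬ Conj s c (-d) := fun h => e4 (H.line_unique h2 hc (H.line_neg hd) h)
    obtain ⟨gS, hS⟩ := H.sPoly_spec ha hb hnab hnab'
    obtain ⟨gT, hT⟩ := H.sPoly_spec hc hd hncd hncd'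
    have VS := H.vanishesAt_sPoly ha hb hab fun e => h0 (by rw [e]; ring)
    have VT := H.vanishesAt_sPoly hc hd hcd fun e => h0' (by rw [e]; ring)
    rw [← hsum] at VT
    classical
    have hG : EuclideanDomain.gcd (sigma A B (sPoly A B M₁ M₂)) (sigma A B (sPoly A B N₁ N₂)) ≠ 0 :=
      fun h => (sigma_monic gS.natDegree_le gS.monic gS.natDegree_eq).1.ne_zero
        (EuclideanDomain.gcd_eq_zero_iff.1 h).1
    have hmem : ∀ Z W, W ∈ enum Z ↔ W ∈ Z := fun Z W => by
      rw [← Multiset.mem_coe, henum, Finset.mem_val]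
    refine ⟨L, H.factorLoop_eq_some h2 gS gT hL (fun z hz Vz Vz' => hC z (hS z hz Vz) (hT z hz Vz'))
      VS VT _ (fun W hW => ?_) ((hmem _ _).2 ?_), hL⟩
    · obtain ⟨hi, hm, hd⟩ := of_mem_cubicFactors hG ((hmem _ _).1 hW)
      exact ⟨hi, hm, hd.trans (EuclideanDomain.gcd_dvd_left _ _),
        hd.trans (EuclideanDomain.gcd_dvd_right _ _)⟩
    · exact H.minX_mem_cubicFactors h0 hG (EuclideanDomain.dvd_gcd
        (H.dvd_sigma_of_vanishesAt h0 VS) (H.dvd_sigma_of_vanishesAt h0 VT))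

end Param
end Param

/-! ### Exceptional residues and Eisenstein integers. -/

/-- The ring of Eisenstein integers `ℤ[ω]`, where `ω² + ω + 1 = 0`. -/
abbrev Eisenstein : Type := QuadraticAlgebra ℤ (-1) (-1)

namespace Eisenstein

/-- The powers `1, ω, ω²`. -/
def root : Fin 3 → Eisenstein := ![⟨1, 0⟩, ⟨0, 1⟩, ⟨-1, -1⟩]

/-- The pairs `(α, β)` for which `α / β`, with `ω` replaced by `s`, is an exceptional residue. -/
def fractions : Fin 6 → Eisenstein × Eisenstein :=
  ![(⟨3, 0⟩, ⟨1, 2⟩), (⟨-3, 0⟩, ⟨1, 2⟩), (⟨-4, 1⟩, ⟨0, 3⟩), (⟨-1, 4⟩, ⟨1, 2⟩), (⟨5, 1⟩, ⟨3, 3⟩),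
    (⟨5, 4⟩, ⟨1, 2⟩)]

/-- The pairs of multiples of `P` in the special case of the ladder. -/
def shifts : Fin 4 → ℤ × ℤ := ![(3, 7), (3, -5), (-3, 5), (-3, -7)]

/-- The nonzero elements of small norm. -/
def Small (z : Eisenstein) : Prop := 0 < z.norm ∧ z.norm ≤ 10800

instance (z : Eisenstein) : Decidable (Small z) := inferInstanceAs (Decidable (_ ∧ _))

theorem small_snd_fractions : ∀ k, Small (fractions k).2 := by decide

/-- Keeps 5 and 7 out of `M`, so the special case never arises before the ladder has three earlier
pairs. -/
theorem small_five_seven : ∀ k, Small (5 * (fractions k).2 - (fractions k).1) ∧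
    Small (7 * (fractions k).2 - (fractions k).1) := by decide

/-- Ensures that the summands `d` and `t - d` differ. -/
theorem small_shifts : ∀ k c,
    Small (2 * (shifts c).1 * (fractions k).2 - (fractions k).1) ∧
    Small (2 * (shifts c).2 * (fractions k).2 - (fractions k).1) := by decide

-- With `t = α / β`, `m` is `β` times a sum from the first pair, and `z` is `β` times its difference
-- from a conjugate of a sum from the second pair. In each of the 648 cases the coincidence is an
-- identity in `ℤ[ω]` placing the sum in the orbit of `t`, or it is excluded by its norm.
set_option maxRecDepth 100000 in
theorem special_relation : ∀ k c i j l,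
    let m := (shifts c).1 * (fractions k).2 +
      root i * ((fractions k).1 - (shifts c).1 * (fractions k).2)
    let z := m - root j * ((shifts c).2 * (fractions k).2 +
      root l * ((fractions k).1 - (shifts c).2 * (fractions k).2))
    (z = 0 ∧ ∃ e, m = root e * (fractions k).1) ∨ Small z := by decide +kernel

/-- The ring homomorphism `ω ↦ s`. -/
noncomputable def toZMod {p : ℕ} {s : ZMod p} (h : s ^ 2 + s + 1 = 0) : Eisenstein →+* ZMod p :=
  (QuadraticAlgebra.lift ⟨s, by
    rw [neg_smul, neg_smul, one_smul, one_smul]; linear_combination h⟩).toRingHom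

theorem toZMod_apply {p : ℕ} {s : ZMod p} (h : s ^ 2 + s + 1 = 0) (z : Eisenstein) :
    toZMod h z = z.re + z.im * s := by
  simp [toZMod]

theorem toZMod_root {p : ℕ} {s : ZMod p} (h : s ^ 2 + s + 1 = 0) (i : Fin 3) :
    toZMod h (root i) = s ^ (i : ℕ) := by
  rw [toZMod_apply]
  fin_cases i
  · simp [root]
  · simp [root]
  · simp [root]
    linear_combination -h

/-- The norm is `z` times its conjugate, so if `z` vanishes modulo `p`, then `p` divides a positive
integer at most 10800. -/
theorem toZMod_ne_zero {p : ℕ} {s : ZMod p} (h : s ^ 2 + s + 1 = 0) (hp : 10800 < p)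
    {z : Eisenstein} (hz : Small z) : toZMod h z ≠ 0 := by
  intro h0
  refine intCast_zmod_ne_zero (p := p) (n := z.norm) hz.1.ne' ?_ ?_
  · have := hz.1
    have := hz.2
    omega
  · rw [toZMod_apply] at h0
    rw [QuadraticAlgebra.norm_def]
    push_cast
    linear_combination (z.re - z.im - z.im * s) * h0 + (z.im : ZMod p) ^ 2 * h

end Eisenstein

/-! ### Common orbits of two triples of sums. -/

section Residues

/-- `x`, `y`, `z` run over the powers of `s`. For `x = 1` the sum is `2k + 1` itself; the other 18
cases are linear equations in `k`. The value `k = 1` is excluded because both pairs are then `(1,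
2)`. -/
theorem eisenstein_cases {R : Type*} [Field R] {s k x y z : R} (h : s ^ 2 + s + 1 = 0)
    (h3 : (3 : R) ≠ 0) (h1 : k ≠ 1) (e1 : (2 * k + 1) * (2 * s + 1) ≠ 3)
    (e2 : (2 * k + 1) * (2 * s + 1) ≠ -3) (e3 : (2 * k + 1) * (3 * s) ≠ s - 4)
    (e4 : (2 * k + 1) * (2 * s + 1) ≠ 4 * s - 1) (e5 : (2 * k + 1) * (3 * (s + 1)) ≠ s + 5)
    (e6 : (2 * k + 1) * (2 * s + 1) ≠ 4 * s + 5) (hx : x = 1 ∨ x = s ∨ x = -s - 1)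
    (hy : y = 1 ∨ y = s ∨ y = -s - 1) (hz : z = 1 ∨ z = s ∨ z = -s - 1)
    (e : 1 + x * (2 * k) = z * (k + y * (k + 1))) :
    1 + x * (2 * k) = 2 * k + 1 ∨ 1 + x * (2 * k) = s * (2 * k + 1) ∨
      1 + x * (2 * k) = (-s - 1) * (2 * k + 1) := by
  rcases hx with rfl | rfl | rfl
  · left; ring
  all_goals rcases hy with rfl | rfl | rfl <;> rcases hz with rfl | rfl | rfl <;> grind

open Eisenstein

variable {p : ℕ} {s : ZMod p}

theorem mem_exceptional_iff_mul [Fact p.Prime] (h : s ^ 2 + s + 1 = 0) (hp : 10800 < p)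
    (t : ZMod p) : t ∈ exceptional p s ↔ t * (2 * s + 1) = 3 ∨ t * (2 * s + 1) = -3 ∨
      t * (3 * s) = s - 4 ∨ t * (2 * s + 1) = 4 * s - 1 ∨ t * (3 * (s + 1)) = s + 5 ∨
        t * (2 * s + 1) = 4 * s + 5 := by
  have hne := fun k => toZMod_ne_zero h hp (small_snd_fractions k)
  have h0 : 2 * s + 1 ≠ 0 := fun e => hne 0 (by
    rw [toZMod_apply]; simp [fractions]; linear_combination e)
  have h2 : 3 * s ≠ 0 := fun e => hne 2 (by rw [toZMod_apply]; simpa [fractions] using e)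
  have h4 : 3 * (s + 1) ≠ 0 := fun e => hne 4 (by
    rw [toZMod_apply]; simp [fractions]; linear_combination e)
  simp only [exceptional, Set.mem_insert_iff, Set.mem_singleton_iff, eq_div_iff h0, eq_div_iff h2,
    eq_div_iff h4]

theorem mem_exceptional_iff [Fact p.Prime] (h : s ^ 2 + s + 1 = 0) (hp : 10800 < p) (t : ZMod p) :
    t ∈ exceptional p s ↔
      ∃ k, t * toZMod h (fractions k).2 = toZMod h (fractions k).1 := by
  rw [mem_exceptional_iff_mul h hp]
  simp only [toZMod_apply, fractions, Fin.exists_fin_succ, IsEmpty.exists_iff, or_false]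
  simp
  ring_nf

theorem conj_iff_fin (h : s ^ 2 + s + 1 = 0) {a b : ZMod p} :
    Conj s a b ↔ ∃ e : Fin 3, b = toZMod h (root e) * a := by
  constructor
  · rintro ⟨i, rfl⟩
    refine ⟨⟨i % 3, Nat.mod_lt _ (by norm_num)⟩, ?_⟩
    have h3 : s ^ 3 = 1 := by linear_combination (s - 1) * h
    rw [toZMod_root]
    conv_lhs => rw [← Nat.div_add_mod i 3, pow_add, pow_mul, h3, one_pow, one_mul]
  · rintro ⟨e, rfl⟩
    exact ⟨e, by rw [toZMod_root]⟩

theorem conj_of_mem_exceptional [Fact p.Prime] (h : s ^ 2 + s + 1 = 0) (hp : 10800 < p)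
    {t : ZMod p} (ht : t ∈ exceptional p s) (c : Fin 4) (i l : Fin 3)
    (hz : Conj s ((shifts c).2 + toZMod h (root l) * (t - (shifts c).2))
      ((shifts c).1 + toZMod h (root i) * (t - (shifts c).1))) :
    Conj s t ((shifts c).1 + toZMod h (root i) * (t - (shifts c).1)) := by
  obtain ⟨k, hk⟩ := (mem_exceptional_iff h hp t).1 ht
  have hb := toZMod_ne_zero h hp (small_snd_fractions k)
  obtain ⟨j, hj⟩ := (conj_iff_fin h).1 hz
  rw [conj_iff_fin h]
  rcases special_relation k c i j l with ⟨-, e, he⟩ | hs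
  · refine ⟨e, mul_right_cancel₀ hb ?_⟩
    have := congrArg (toZMod h) he
    simp only [map_add, map_mul, map_sub, map_intCast] at this
    linear_combination this + (toZMod h (root i) - toZMod h (root e)) * hk
  · refine absurd ?_ (toZMod_ne_zero h hp hs)
    simp only [map_add, map_mul, map_sub, map_intCast]
    linear_combination toZMod h (fractions k).2 * hj + (toZMod h (root j) * toZMod h (root l) -
      toZMod h (root i)) * hk

theorem ne_two_mul_shifts [Fact p.Prime] (h : s ^ 2 + s + 1 = 0) (hp : 10800 < p)
    {t : ZMod p} (ht : t ∈ exceptional p s) (c : Fin 4) :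
    t ≠ 2 * (shifts c).1 ∧ t ≠ 2 * (shifts c).2 := by
  obtain ⟨k, hk⟩ := (mem_exceptional_iff h hp t).1 ht
  constructor
  · rintro rfl
    refine toZMod_ne_zero h hp (small_shifts k c).1 ?_
    simp only [map_mul, map_sub, map_intCast, map_ofNat, hk, sub_self]
  · rintro rfl
    refine toZMod_ne_zero h hp (small_shifts k c).2 ?_
    simp only [map_mul, map_sub, map_intCast, map_ofNat, hk, sub_self]

theorem five_seven_notMem_exceptional [Fact p.Prime] (h : s ^ 2 + s + 1 = 0) (hp : 10800 < p) :
    (5 : ZMod p) ∉ exceptional p s ∧ (7 : ZMod p) ∉ exceptional p s := by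
  simp only [mem_exceptional_iff h hp, not_exists]
  constructor <;> intro k hk
  · refine toZMod_ne_zero h hp (small_five_seven k).1 ?_
    simp only [map_mul, map_sub, map_ofNat, hk, sub_self]
  · refine toZMod_ne_zero h hp (small_five_seven k).2 ?_
    simp only [map_mul, map_sub, map_ofNat, hk, sub_self]

/-- The two triples of sums used in the general case have only the conjugates of `2k + 1` in
common. -/
theorem conj_of_notMem_exceptional [Fact p.Prime] (h : s ^ 2 + s + 1 = 0) (hp : 10800 < p)
    {k : ZMod p} (hk : 2 * k + 1 ∉ exceptional p s) (h1 : k ≠ 1) (i l : Fin 3)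
    (hz : Conj s (k + toZMod h (root l) * (k + 1)) (1 + toZMod h (root i) * (2 * k))) :
    Conj s (2 * k + 1) (1 + toZMod h (root i) * (2 * k)) := by
  obtain ⟨j, hj⟩ := (conj_iff_fin h).1 hz
  have h3 : (3 : ZMod p) ≠ 0 := by
    exact_mod_cast intCast_zmod_ne_zero (p := p) (n := 3) (by norm_num) (by norm_num; omega)
  have hr : ∀ e : Fin 3, toZMod h (root e) = 1 ∨ toZMod h (root e) = s ∨
      toZMod h (root e) = -s - 1 := by
    intro e
    fin_cases e <;> simp [toZMod_apply, root, sub_eq_add_neg, add_comm]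
  simp only [mem_exceptional_iff_mul h hp, not_or] at hk
  obtain ⟨e1, e2, e3, e4, e5, e6⟩ := hk
  have := eisenstein_cases h h3 h1 e1 e2 e3 e4 e5 e6 (hr i) (hr l) (hr j) hj
  rw [conj_iff_fin h]
  rcases this with e | e | e
  · exact ⟨0, by rw [e]; simp [toZMod_apply, root]⟩
  · exact ⟨1, by rw [e]; simp [toZMod_apply, root]⟩
  · exact ⟨2, by rw [e]; simp [toZMod_apply, root, sub_eq_add_neg, add_comm]⟩

end Residues

/-! ### Single steps of the ladder. -/

section Param

open Eisenstein

variable {F : Type*} [Field F] [Fintype F] {K : Type*} [Field K] [DecidableEq K] [Algebra F K]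
  {A B : F} {p : ℕ} {s : ZMod p} {pt : ZMod p →+ Points K A B}

/-- The computation `x` succeeds, and its result is the line of `pt a`. -/
def Computes (pt : ZMod p →+ Points K A B) (x : Option (Line F)) (a : ZMod p) : Prop :=
  ∃ L : Line F, x = some L ∧ IsLineOf L (pt a)

theorem exists_conj_root (h : s ^ 2 + s + 1 = 0) {a b z : ZMod p}
    (hz : Conj s (a + b) z ∨ Conj s (a + s * b) z ∨ Conj s (a + s ^ 2 * b) z) :
    ∃ i : Fin 3, Conj s (a + toZMod h (root i) * b) z := by
  simp only [toZMod_root]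
  rcases hz with hz | hz | hz
  · exact ⟨0, by simpa using hz⟩
  · exact ⟨1, by simpa using hz⟩
  · exact ⟨2, by simpa using hz⟩

theorem natCast_zmod_ne_zero {n : ℕ} (h0 : n ≠ 0) (h : n < p) : (n : ZMod p) ≠ 0 := by
  have := intCast_zmod_ne_zero (p := p) (n := n) (by exact_mod_cast h0) (by simpa using h)
  exact_mod_cast this

namespace Param

theorem computes_D (H : Param p s pt) {x : Option (Line F)} {a : ZMod p}
    (h : Computes pt x a) : Computes pt (D A B x) (2 * a) := by
  obtain ⟨L, rfl, hL⟩ := h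
  exact H.isLineOf_dbl hL

theorem computes_lineOf (H : Param p s pt) {P : Points K A B} (hP : pt 1 = P) {n : ℤ}
    (hn : (n : ZMod p) ≠ 0) : Computes pt (lineOf (n • P)) n := by
  have he : pt n = n • P := by rw [← hP, ← map_zsmul, zsmul_one]
  have hex := H.exists_line hn
  rw [he] at hex
  refine ⟨hex.choose, dif_pos hex, ?_⟩
  rw [he]
  exact hex.choose_spec

theorem computes_Subalg_general (H : Param p s pt) (h2 : ringChar F ≠ 2)
    {enum : Finset F[X] → List F[X]} (henum : ∀ Z : Finset F[X], (enum Z : Multiset F[X]) = Z.val)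
    {k : ZMod p} {x₁ x₂ x₃ x₄ : Option (Line F)} (hx₁ : Computes pt x₁ 1)
    (hx₂ : Computes pt x₂ (2 * k)) (hx₃ : Computes pt x₃ k) (hx₄ : Computes pt x₄ (k + 1))
    [Fact p.Prime] (hk : 2 * k + 1 ∉ exceptional p s) (hk1 : k ≠ 1) (hk2 : 1 ≠ 2 * k) (hk0 : 2 * k + 1 ≠ 0) :
    Computes pt (Subalg enum A B x₁ x₂ x₃ x₄) (2 * k + 1) := by
  obtain ⟨M₁, rfl, h₁⟩ := hx₁
  obtain ⟨M₂, rfl, h₂⟩ := hx₂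
  obtain ⟨N₁, rfl, h₃⟩ := hx₃
  obtain ⟨N₂, rfl, h₄⟩ := hx₄
  have key := H.subalg_eq_some h2 henum h₁ h₂ h₃ h₄ (by ring) (by rwa [add_comm]) hk2
    (fun h => H.one_ne (by linear_combination -h)) fun z hz hz' => by
      obtain ⟨i, hi⟩ := exists_conj_root H.rel hz
      obtain ⟨l, hl⟩ := exists_conj_root H.rel hz'
      rw [add_comm]
      exact (conj_of_notMem_exceptional H.rel H.large hk hk1 i l
        (hl.trans (H.conj_symm hi))).trans hi
  rw [add_comm]
  exact key

theorem computes_Subalg_special (H : Param p s pt) (h2 : ringChar F ≠ 2)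
    {enum : Finset F[X] → List F[X]} (henum : ∀ Z : Finset F[X], (enum Z : Multiset F[X]) = Z.val)
    {t : ZMod p} (c : Fin 4) {x₁ x₂ x₃ x₄ : Option (Line F)}
    (hx₁ : Computes pt x₁ (shifts c).1) (hx₂ : Computes pt x₂ (t - (shifts c).1))
    (hx₃ : Computes pt x₃ (shifts c).2) (hx₄ : Computes pt x₄ (t - (shifts c).2))
    [Fact p.Prime] (ht : t ∈ exceptional p s) (ht0 : t ≠ 0) :
    Computes pt (Subalg enum A B x₁ x₂ x₃ x₄) t := by
  obtain ⟨M₁, rfl, h₁⟩ := hx₁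
  obtain ⟨M₂, rfl, h₂⟩ := hx₂
  obtain ⟨N₁, rfl, h₃⟩ := hx₃
  obtain ⟨N₂, rfl, h₄⟩ := hx₄
  obtain ⟨n1, n2⟩ := ne_two_mul_shifts H.rel H.large ht c
  have e : ∀ d : ZMod p, d + (t - d) = t := fun d => by ring
  have key := H.subalg_eq_some h2 henum h₁ h₂ h₃ h₄ (by ring) (by rwa [e])
    (fun h => n1 (by linear_combination -h)) (fun h => n2 (by linear_combination -h))
    fun z hz hz' => by
      obtain ⟨i, hi⟩ := exists_conj_root H.rel hz
      obtain ⟨l, hl⟩ := exists_conj_root H.rel hz'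
      rw [e]
      exact (conj_of_mem_exceptional H.rel H.large ht c i l (hl.trans (H.conj_symm hi))).trans hi
  rwa [e] at key

end Param

end Param

/-! ### Induction along the binary prefixes. -/

section BinPrefix

theorem binPrefix_eq (m i : ℕ) :
    binPrefix m i = 2 * binPrefix m (i + 1) + (m.testBit i).toNat := by
  rw [binPrefix, binPrefix, pow_succ, ← Nat.div_div_eq_div_mul, Nat.testBit_eq_decide_div_mod_eq]
  rcases Nat.mod_two_eq_zero_or_one (m / 2 ^ i) with h | h <;> simp [h] <;> omega

theorem binPrefix_le (m i : ℕ) : binPrefix m i ≤ m := Nat.div_le_self _ _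

theorem binPrefix_pos {m i : ℕ} (h : i < m.size) : 0 < binPrefix m i :=
  Nat.div_pos (Nat.lt_size.1 h) (by positivity)

theorem binPrefix_of_succ_eq_size {m i : ℕ} (h : i + 1 = m.size) : binPrefix m i = 1 := by
  have h1 : binPrefix m i < 2 := by
    rw [binPrefix, Nat.div_lt_iff_lt_mul (by positivity), ← pow_succ', h]
    exact Nat.lt_size_self m
  have := binPrefix_pos (m := m) (i := i) (by omega)
  omega

end BinPrefix

section Param

open Eisenstein

variable {F : Type*} [Field F] [Fintype F] {K : Type*} [Field K] [DecidableEq K] [Algebra F K]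
  {A B : F} {p : ℕ} [Fact p.Prime] {s : ZMod p} {pt : ZMod p →+ Points K A B}

/-- Exactly one of `k_i`, `k_i + 1` is odd, namely `2k_{i+1} + 1`, whatever the bit `m_i`. -/
theorem special_iff {m i : ℕ} (h : 2 * binPrefix m (i + 1) + 1 < p) :
    (binPrefix m i ∈ oddExceptional p s ∨ binPrefix m i + 1 ∈ oddExceptional p s) ↔
      2 * (binPrefix m (i + 1) : ZMod p) + 1 ∈ exceptional p s := by
  have e : ((2 * binPrefix m (i + 1) + 1 : ℕ) : ZMod p) = 2 * (binPrefix m (i + 1) : ZMod p) + 1 := by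
    push_cast; rfl
  rw [← e]
  have ho : Odd (2 * binPrefix m (i + 1) + 1) := ⟨_, rfl⟩
  have he : ¬ Odd (2 * binPrefix m (i + 1)) := by simp
  have he' : ¬ Odd (2 * binPrefix m (i + 1) + 1 + 1) := by simp [Nat.odd_add_one]
  rw [binPrefix_eq m i]
  have hodd : ∀ n, n ∈ oddExceptional p s ↔ Odd n ∧ n < p ∧ (n : ZMod p) ∈ exceptional p s :=
    fun _ => Iff.rfl
  cases m.testBit i <;> simp only [Bool.toNat_false, Bool.toNat_true, add_zero, hodd, ho, he, he', h,
    true_and, false_and, or_false, false_or]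

/-- For either value of the bit, one new line is a double and the other, `w`, belongs to the odd
number `t = 2k_{i+1} + 1`. -/
theorem Param.computes_ladder (H : Param p s pt) (h2 : ringChar F ≠ 2)
    {enum : Finset F[X] → List F[X]} (henum : ∀ Z : Finset F[X], (enum Z : Multiset F[X]) = Z.val)
    {P : Points K A B} (hP : pt 1 = P) {m : ℕ} (hm : m < p) (i : ℕ) (hi : i < m.size) :
    Computes pt (ladder enum P p s m i).1 (binPrefix m i : ZMod p) ∧
      (binPrefix m i + 1 ≠ p →
        Computes pt (ladder enum P p s m i).2 ((binPrefix m i : ZMod p) + 1)) := by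
  have hp := H.large
  have small : ∀ n : ℤ, n ≠ 0 → n.natAbs ≤ 10800 → Computes pt (lineOf (n • P)) n :=
    fun n h0 h => H.computes_lineOf hP (H.int_ne n h0 h)
  have cong : ∀ {x : Option (Line F)} {a b : ZMod p}, Computes pt x a → a = b →
    Computes pt x b := fun h e => e ▸ h
  induction hn : m.size - i using Nat.strong_induction_on generalizing i with
  | _ n ih =>
    have hki := binPrefix_eq m i
    have hle := binPrefix_le m i
    rw [ladder, if_neg (by omega)]
    by_cases h1 : i + 1 = m.size
    · rw [if_pos h1, binPrefix_of_succ_eq_size h1]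
      exact ⟨cong (small 1 (by norm_num) (by norm_num)) (by norm_num),
        fun _ => cong (small 2 (by norm_num) (by norm_num)) (by norm_num)⟩
    rw [if_neg h1]
    by_cases h1' : i + 2 = m.size
    · rw [if_pos h1', hki, binPrefix_of_succ_eq_size (by omega)]
      cases m.testBit i
      · exact ⟨cong (small 2 (by norm_num) (by norm_num)) (by norm_num),
          fun _ => cong (small 3 (by norm_num) (by norm_num)) (by norm_num)⟩
      · exact ⟨cong (small 3 (by norm_num) (by norm_num)) (by norm_num),
          fun _ => cong (small 4 (by norm_num) (by norm_num)) (by norm_num)⟩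
    rw [if_neg h1']
    have hk1 : binPrefix m (i + 1) = 2 * binPrefix m (i + 2) + (m.testBit (i + 1)).toNat :=
      binPrefix_eq m (i + 1)
    have hk2pos := binPrefix_pos (m := m) (i := i + 2) (by omega)
    have ht0 : ∀ h : 2 * binPrefix m (i + 1) + 1 < p, 2 * (binPrefix m (i + 1) : ZMod p) + 1 ≠ 0 :=
      fun h => by exact_mod_cast natCast_zmod_ne_zero (by omega) h
    obtain ⟨hu₁, hv₁⟩ := ih _ (by omega) (i + 1) (by omega) rfl
    obtain ⟨hu₂, hv₂⟩ := ih _ (by omega) (i + 2) (by omega) rfl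
    -- Since `2k_{i+1} ≤ k_i < p`, the exception `k + 1 = p` cannot occur at an earlier stage.
    replace hv₁ := hv₁ (by omega)
    replace hv₂ := hv₂ (by omega)
    classical
    dsimp only
    generalize hw : @ite _ (binPrefix m i ∈ oddExceptional p s ∨
      binPrefix m i + 1 ∈ oddExceptional p s) _ _ _ = w
    have key : 2 * binPrefix m (i + 1) + 1 < p →
        Computes pt w (2 * (binPrefix m (i + 1) : ZMod p) + 1) := by
      intro hlt
      by_cases hM : 2 * (binPrefix m (i + 1) : ZMod p) + 1 ∈ exceptional p s
      · rw [if_pos ((special_iff hlt).2 hM)] at hw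
        -- Otherwise `k_{i+2} = 1`, so `t` is 5 or 7, neither of which is exceptional.
        have hi3 : i + 3 < m.size := by
          by_contra hi3
          have e2 := binPrefix_of_succ_eq_size (m := m) (i := i + 2) (by omega)
          obtain ⟨n5, n7⟩ := five_seven_notMem_exceptional H.rel hp
          rw [hk1, e2] at hM
          cases h : m.testBit (i + 1)
          · refine n5 ?_
            rw [h] at hM
            norm_num at hM
            exact hM
          · refine n7 ?_
            rw [h] at hM
            norm_num at hM
            exact hM
        have hk2 : binPrefix m (i + 2) = 2 * binPrefix m (i + 3) + (m.testBit (i + 2)).toNat :=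
          binPrefix_eq m (i + 2)
        obtain ⟨hu₃, hv₃⟩ := ih _ (by omega) (i + 3) (by omega) rfl
        replace hv₃ := hv₃ (by omega)
        have hk1' := congrArg (Nat.cast (R := ZMod p)) hk1
        have hk2' := congrArg (Nat.cast (R := ZMod p)) hk2
        rw [← hw]
        cases b1 : m.testBit (i + 1) <;> cases b2 : m.testBit (i + 2) <;>
          simp only [b1, b2, Bool.toNat_false, Bool.toNat_true, Nat.cast_add, Nat.cast_mul,
            Nat.cast_ofNat, Nat.cast_one, add_zero] at hk1' hk2' ⊢
        -- For the bits `00, 01, 10, 11` of `m_{i+1} m_{i+2}`, `t` is `8k_{i+3}` plus 1, 5, 3, 7.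
        -- The shifts are chosen so that each `t - d` is 4 or 8 times an available prefix or its
        -- successor, reached by doublings alone.
        · refine H.computes_Subalg_special h2 henum 3 (small (-3) (by norm_num) (by norm_num))
            (cong (H.computes_D (H.computes_D hv₂)) ?_) (small (-7) (by norm_num) (by norm_num))
            (cong (H.computes_D (H.computes_D (H.computes_D hv₃))) ?_) hM (ht0 hlt)
          all_goals simp only [shifts, hk1', hk2']; simp; ring
        · refine H.computes_Subalg_special h2 henum 2 (small (-3) (by norm_num) (by norm_num))
            (cong (H.computes_D (H.computes_D (H.computes_D hv₃))) ?_)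
            (small 5 (by norm_num) (by norm_num))
            (cong (H.computes_D (H.computes_D (H.computes_D hu₃))) ?_) hM (ht0 hlt)
          all_goals simp only [shifts, hk1', hk2']; simp; ring
        · refine H.computes_Subalg_special h2 henum 1 (small 3 (by norm_num) (by norm_num))
            (cong (H.computes_D (H.computes_D (H.computes_D hu₃))) ?_)
            (small (-5) (by norm_num) (by norm_num))
            (cong (H.computes_D (H.computes_D (H.computes_D hv₃))) ?_) hM (ht0 hlt)
          all_goals simp only [shifts, hk1', hk2']; simp; ring
        · refine H.computes_Subalg_special h2 henum 0 (small 3 (by norm_num) (by norm_num))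
            (cong (H.computes_D (H.computes_D hu₂)) ?_) (small 7 (by norm_num) (by norm_num))
            (cong (H.computes_D (H.computes_D (H.computes_D hu₃))) ?_) hM (ht0 hlt)
          all_goals simp only [shifts, hk1', hk2']; simp; ring
      · rw [if_neg (mt (special_iff hlt).1 hM)] at hw
        rw [← hw]
        refine H.computes_Subalg_general h2 henum
          (cong (small 1 (by norm_num) (by norm_num)) (by norm_num)) (H.computes_D hu₁) hu₁ hv₁ hM
          (fun h => ?_) (fun h => ?_) (ht0 hlt)
        · refine natCast_zmod_ne_zero (p := p) (n := binPrefix m (i + 1) - 1) (by omega) (by omega) ?_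
          rw [Nat.cast_sub (by omega), h, Nat.cast_one, sub_self]
        · refine natCast_zmod_ne_zero (p := p) (n := 2 * binPrefix m (i + 1) - 1) (by omega)
            (by omega) ?_
          rw [Nat.cast_sub (by omega), Nat.cast_mul, Nat.cast_ofNat, ← h, Nat.cast_one, sub_self]
    have hki' := congrArg (Nat.cast (R := ZMod p)) hki
    cases b : m.testBit i <;> simp only [b, Bool.toNat_false, Bool.toNat_true, if_true] at hki hki' ⊢
    · rw [if_neg (by simp)]
      refine ⟨cong (H.computes_D hu₁) ?_, fun h => cong (key (by omega)) ?_⟩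
      all_goals rw [hki']; push_cast; ring
    · refine ⟨cong (key (by omega)) ?_, fun h => cong (H.computes_D hv₁) ?_⟩
      all_goals rw [hki']; push_cast; ring

end Param

/-! ### From the generator `P` to the parametrization. -/

section Param

variable {F : Type*} [Field F] [Fintype F] {K : Type*} [Field K] [DecidableEq K] [Algebra F K]
  {A B : F}

/-- A generator of the trace zero subgroup of large prime order gives a parametrization. -/
theorem exists_param (h2 : ringChar F ≠ 2) (hK : Module.finrank F K = 3) {p : ℕ} [hpr : Fact p.Prime]
    (hp : 10800 < p) {P : Points K A B} (hP : addOrderOf P = p) (hT : P ∈ traceZero K A B)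
    {s : ZMod p} (hs : frob P = s.val • P) :
    ∃ pt : ZMod p →+ Points K A B, Param p s pt ∧ pt 1 = P := by
  obtain ⟨pt, h1, hinj⟩ : ∃ pt : ZMod p →+ Points K A B, pt 1 = P ∧ Function.Injective pt := by
    -- `n ↦ n • P` has kernel `pℤ`, so it descends injectively to `ZMod p`.
    let f : { f : ℤ →+ Points K A B // f p = 0 } :=
      ⟨zmultiplesHom _ P, by simp [← hP, addOrderOf_nsmul_eq_zero]⟩
    refine ⟨ZMod.lift p f, by simpa [f] using ZMod.lift_coe p f 1,
      (ZMod.lift_injective p).2 fun n hn => ?_⟩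
    have hn' : n • P = 0 := hn
    rw [← addOrderOf_dvd_iff_zsmul_eq_zero, hP] at hn'
    exact (ZMod.intCast_zmod_eq_zero_iff_dvd n p).2 hn'
  have hval : ∀ a : ZMod p, pt a = a.val • P := fun a => by
    conv_lhs => rw [← ZMod.natCast_zmod_val a, ← nsmul_one, map_nsmul, h1]
  have hfrob : ∀ a, frob (pt a) = pt (s * a) := by
    intro a
    rw [hval a, map_nsmul, hs, ← hval s, ← map_nsmul, nsmul_eq_mul, ZMod.natCast_zmod_val, mul_comm]
  refine ⟨pt, ⟨hK, ?_, hpr.out, hp, hinj, hfrob, ?_⟩, h1⟩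
  · have h2' := (_root_.map_ne_zero (algebraMap F K)).2 (Ring.two_ne_zero h2)
    rwa [map_ofNat] at h2'
  · have hz : P + frob P + frob (frob P) = 0 := hT
    rw [← h1, hfrob, hfrob, ← map_add, ← map_add, map_eq_zero_iff _ hinj] at hz
    linear_combination hz

end Param

end T3

theorem mainTheorem3 {F K : Type*} [Field F] [Fintype F] [Field K] [DecidableEq K] [Algebra F K]
    (h2 : ringChar F ≠ 2) (h3 : ringChar F ≠ 3) (hK : Module.finrank F K = 3)
    (A B : F) (hAB : 4 * A ^ 3 + 27 * B ^ 2 ≠ 0)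
    (p : ℕ) [Fact p.Prime] (hp : 10800 < p)
    (P : T3.Points K A B) (hP : addOrderOf P = p)
    (hT : T3.traceZero K A B = AddSubgroup.zmultiples P)
    (s : ZMod p) (hs : T3.frob P = s.val • P)
    (enum : Finset (Polynomial F) → List (Polynomial F))
    (henum : ∀ Z : Finset (Polynomial F), (enum Z : Multiset (Polynomial F)) = Z.val)
    (m : ℕ) (hm0 : 0 < m) (hmp : m < p) :
    ∀ i < m.size,
      (∃ u : T3.Line F, (T3.ladder enum P p s m i).1 = some u ∧
        T3.IsLineOf u (T3.binPrefix m i • P)) ∧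
      (T3.binPrefix m i + 1 ≠ p →
        ∃ v : T3.Line F, (T3.ladder enum P p s m i).2 = some v ∧
          T3.IsLineOf v ((T3.binPrefix m i + 1) • P)) := by
  intro i hi
  obtain ⟨pt, H, h1⟩ := T3.exists_param h2 hK hp hP
    (hT ▸ AddSubgroup.mem_zmultiples P) hs
  have hn : ∀ n : ℕ, n • P = pt n := fun n => by rw [← h1, ← map_nsmul, nsmul_one]
  rw [hn, hn, Nat.cast_add, Nat.cast_one]
  exact H.computes_ladder h2 henum h1 hmp i hi
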